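/- **Setting.** Fix integers $d,e\ge 1$ and a colouring parity $s\in\{0,1\}$. The rotated surface-code patch $(d,e,s)$ has qubits $(r,c)$, $0\le r<d$, $0\le c<e$ ($d$ rows, $e$ columns). For $0\le a\le d$, $0\le b\le e$ the tile $(a,b)$ consists of those of the qubits $(a-1,b-1),(a-1,b),(a,b-1),(a,b)$ that exist. The $X$ stabiliser generators are $X^{\otimes}$ on the tiles with $0<a<d$ and $a+b+s$ odd (interior tiles, and weight-two blobs on the left and right boundaries for $b\in\{0,e\}$); the $Z$ stabiliser generators are $Z^{\otimes}$ on the tiles with $0<b<e$ and $a+b+s$ even (interior tiles, and weight-two blobs on the top and bottom boundaries for $a\in\{0,d\}$). The logical operators are $\overline{\mathcal X}=X^{\otimes}$ on the bottom row and $\overline{\mathcal Z}=Z^{\otimes}$ on the leftmost column. (For $d=e=3$, $s=0$ this is the 9-qubit patch.) Its encoder $E_{d,e,s}:\mathbb C^2\to(\mathbb C^2)^{\otimes de}$ is $$E_{d,e,s}|x\rangle = 2^{-g/2}\sum_{c\in\mathbb F_2^{g}}\Big|\,x\,\ell_X+\sum_{t}c_t\,v_t\Big\rangle ,$$ where $v_1,\dots,v_g\in\mathbb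 F_2^{de}$ are the supports of the $X$ generators and $\ell_X$ that of $\overline{\mathcal X}$ (the normalised ZX diagram of the $X$-representation). The $Z$-representation is $H^{\otimes de}\circ M\circ H$, where $M$ is given by the same formula with the $Z$ generators and $\overline{\mathcal Z}$. Let $\textit{Z-split}=|00\rangle\langle 0|+|11\rangle\langle 1|$ and $\textit{X-split}=|{+}{+}\rangle\langle{+}|+|{-}{-}\rangle\langle{-}|$. For $k\in\{0,1\}$ let $\textit{X-merge}_k=(|{+}\rangle\langle{+}{+}|+|{-}\rangle\langle{-}{-}|)(Z^k\otimes I)$ and $\textit{Z-merge}_k=(|0\rangle\langle 00|+|1\rangle\langle 11|)(X^k\otimes I)$. Measuring a Pauli operator $P$ with outcome $j\in\{0,1\}$ acts as $\tfrac12(I+(-1)^jP)$. Write $A\equiv_{\lambda}B$ if $A=\lambda\,P\,B$ for some Pauli string $P$ (a product of $X$'s and $Z$'s) on the output qubits (equality up to error correction). **Theorem.** 0. For all $d,e\ge1$ and $s$, the $X$- and $Z$-representations define the same map $E_{d,e,s}$. It is an isometry onto the joint $+1$ eigenspace of the stabiliser generators, and $\overline{\mathcal X}E=EX$, $\overline{\mathcal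 Z}E=EZ$. Let $d,d_1,d_2,e,e_1,e_2\ge 1$ and $s$ be arbitrary. In the $d\times(e_1+e_2)$ patch, the left $e_1$ columns and the right $e_2$ columns are regarded as patches with encoders $E_{d,e_1,s}$ and $E_{d,e_2,s+e_1}$. In the $(d_1+d_2)\times e$ patch, the upper $d_1$ and lower $d_2$ rows are regarded as patches with encoders $E_{d_1,e,s}$ and $E_{d_2,e,s+d_1}$. The following hold for every tuple $j$ of measurement outcomes. 1. (Z-split) Let $\mathrm{SPLIT}_j$ be the $XX$ measurements along the $e_1$-th column of the $d\times(e_1+e_2)$ patch, on the $X$ blobs that would lie on the right boundary of the left $d\times e_1$ patch, and let $q$ be their number. Then $$\mathrm{SPLIT}_j\,E_{d,e_1+e_2,s}\equiv_{2^{-q/2}}(E_{d,e_1,s}\otimes E_{d,e_2,s+e_1})\,\textit{Z-split}.$$ 2. (X-merge) Let $\mathrm{MERGE}_j$ be the measurements of all $X$ stabilisers of the $(d_1+d_2)\times e$ patch that meet both the upper and the lower patch, let $q$ be their number (always at least $1$), and $k=j_1\oplus\dots\oplus j_q$. Then $$\mathrm{MERGE}_j\,(E_{d_1,e,s}\otimes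 E_{d_2,e,s+d_1})\equiv_{2^{-(q-1)/2}}E_{d_1+d_2,e,s}\,\textit{X-merge}_k .$$ 3. (X-split) Let $\mathrm{SPLIT}'_j$ be the $ZZ$ measurements along the $d_1$-th row of the $(d_1+d_2)\times e$ patch, on the $Z$ blobs that would lie on the bottom boundary of the upper $d_1\times e$ patch, and let $q$ be their number. Then $$\mathrm{SPLIT}'_j\,E_{d_1+d_2,e,s}\equiv_{2^{-q/2}}(E_{d_1,e,s}\otimes E_{d_2,e,s+d_1})\,\textit{X-split}.$$ 4. (Z-merge) Let $\mathrm{MERGE}'_j$ be the measurements of all $Z$ stabilisers of the $d\times(e_1+e_2)$ patch that meet both the left and the right patch, let $q$ be their number (always at least $1$), and $k=j_1\oplus\dots\oplus j_q$. Then $$\mathrm{MERGE}'_j\,(E_{d,e_1,s}\otimes E_{d,e_2,s+e_1})\equiv_{2^{-(q-1)/2}}E_{d,e_1+e_2,s}\,\textit{Z-merge}_k .$$ -/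

import Mathlib

open scoped Matrix

namespace LatticeSurgery

/-! ### Qubit registers, Pauli strings, spiders, measurements -/

/-- Linear maps from the qubits indexed by `ι` to the qubits indexed by `κ`, as matrices in the
computational basis; a basis state is a bit string `ι → ZMod 2`. Composition is `G * F`. -/
abbrev QMap (ι κ : Type) := Matrix (κ → ZMod 2) (ι → ZMod 2) ℂ

/-- The sign `(-1)^b`. -/
def sgn (b : ZMod 2) : ℂ := if b = 0 then 1 else -1

/-- The Pauli string `X^u Z^v`, that is `|x⟩ ↦ (-1)^(v·x) |x + u⟩`. -/
def pauli {ι : Type} [Fintype ι] [DecidableEq ι] (u v : ι → ZMod 2) : QMap ι ι :=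
  fun y x => if y = x + u then sgn (∑ i, v i * x i) else 0

/-- `X` on every qubit in the support of `u`. -/
def pauliX {ι : Type} [Fintype ι] [DecidableEq ι] (u : ι → ZMod 2) : QMap ι ι := pauli u 0

/-- `Z` on every qubit in the support of `v`. -/
def pauliZ {ι : Type} [Fintype ι] [DecidableEq ι] (v : ι → ZMod 2) : QMap ι ι := pauli 0 v

/-- The projector `(I + (-1)^k P) / 2` that belongs to outcome `k` of a measurement of `P`. -/
noncomputable def proj {ι : Type} [Fintype ι] [DecidableEq ι] (P : QMap ι ι) (k : ZMod 2) :
    QMap ι ι :=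
  (1 / 2 : ℂ) • (1 + sgn k • P)

/-- The state `|b⟩ ⊗ ⋯ ⊗ |b⟩` on `n` qubits. -/
def ketZ (n : ℕ) (b : ZMod 2) : (Fin n → ZMod 2) → ℂ :=
  fun y => ∏ i, if y i = b then 1 else 0

/-- The state `|+⟩ ⊗ ⋯ ⊗ |+⟩` (for `b = 0`) or `|-⟩ ⊗ ⋯ ⊗ |-⟩` (for `b = 1`) on `n` qubits. -/
noncomputable def ketX (n : ℕ) (b : ZMod 2) : (Fin n → ZMod 2) → ℂ :=
  fun y => ∏ i, sgn (b * y i) / (√2 : ℝ)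

/-- The Z spider with `m` inputs, `n` outputs and phase `α`. -/
noncomputable def zSpider (m n : ℕ) (α : ℝ) : QMap (Fin m) (Fin n) :=
  Matrix.vecMulVec (ketZ n 0) (star (ketZ m 0)) +
    Complex.exp (α * Complex.I) • Matrix.vecMulVec (ketZ n 1) (star (ketZ m 1))

/-- The X spider with `m` inputs, `n` outputs and phase `α`. -/
noncomputable def xSpider (m n : ℕ) (α : ℝ) : QMap (Fin m) (Fin n) :=
  Matrix.vecMulVec (ketX n 0) (star (ketX m 0)) +
    Complex.exp (α * Complex.I) • Matrix.vecMulVec (ketX n 1) (star (ketX m 1))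

/-- The tensor product of two maps, where `φ` and `ψ` say how the two input registers and the two
output registers sit inside the joint input and output registers. -/
def tensor {ι₁ ι₂ ι κ₁ κ₂ κ : Type} (φ : ι₁ ⊕ ι₂ ≃ ι) (ψ : κ₁ ⊕ κ₂ ≃ κ)
    (A : QMap ι₁ κ₁) (B : QMap ι₂ κ₂) : QMap ι κ :=
  fun y x => A (fun q => y (ψ (.inl q))) (fun q => x (φ (.inl q))) *
    B (fun q => y (ψ (.inr q))) (fun q => x (φ (.inr q)))

/-- Two single logical qubits next to each other. -/
def twoQubits : Fin 1 ⊕ Fin 1 ≃ Fin 2 := finSumFinEquiv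

/-- The Hadamard gate on every qubit of a register. -/
noncomputable def hadamard (ι : Type) [Fintype ι] : QMap ι ι :=
  fun y x => ∏ i, sgn (y i * x i) / (√2 : ℝ)

/-- `A` and `B` agree up to error correction with scalar factor `c`: `A = c • P * B` for some
Pauli string `P` on the outputs. -/
def EqUpToPauli {ι κ : Type} [Fintype κ] [DecidableEq κ] (c : ℂ) (A B : QMap ι κ) : Prop :=
  ∃ u v : κ → ZMod 2, A = c • (pauli u v * B)

/-! ### Logical operations -/

/-- Z-split: the phase-free Z spider with one input and two outputs. -/
noncomputable def zSplit : QMap (Fin 1) (Fin 2) := zSpider 1 2 0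

/-- X-split: the phase-free X spider with one input and two outputs. -/
noncomputable def xSplit : QMap (Fin 1) (Fin 2) := xSpider 1 2 0

/-- Branch `k` of the X-merge: the X spider with two inputs and one output, preceded by a Z phase
`kπ` on the first input. -/
noncomputable def xMerge (k : ZMod 2) : QMap (Fin 2) (Fin 1) :=
  xSpider 2 1 0 * tensor twoQubits twoQubits (zSpider 1 1 (k.val * Real.pi)) 1

/-- Branch `k` of the Z-merge: the Z spider with two inputs and one output, preceded by an X phase
`kπ` on the first input. -/
noncomputable def zMerge (k : ZMod 2) : QMap (Fin 2) (Fin 1) :=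
  zSpider 2 1 0 * tensor twoQubits twoQubits (xSpider 1 1 (k.val * Real.pi)) 1

/-! ### The rotated surface code

A patch has `d` rows and `e` columns of qubits `(r, c)`. Tile `(a, b)`, for `a ≤ d` and `b ≤ e`, is
the unit square whose corners are the qubits in rows `a - 1, a` and columns `b - 1, b`, as far as
these exist: tiles with `a = 0` or `a = d` stick out at the top or bottom boundary, tiles with
`b = 0` or `b = e` at the left or right boundary. Tiles are coloured like a checkerboard whose phase
is the parity of `s`. -/

/-- Qubits of a patch with `d` rows and `e` columns. -/
abbrev Qubit (d e : ℕ) := Fin d × Fin e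

/-- The support of tile `(a, b)`. -/
def tile (d e a b : ℕ) : Qubit d e → ZMod 2 := fun q =>
  if (q.1.val = a ∨ q.1.val + 1 = a) ∧ (q.2.val = b ∨ q.2.val + 1 = b) then 1 else 0

/-- X tiles: the interior tiles of odd colour, and the weight-two blobs of odd colour at the left and
right boundaries. -/
abbrev XTile (d e s : ℕ) :=
  {t : Fin (d + 1) × Fin (e + 1) // 0 < t.1.val ∧ t.1.val < d ∧ Odd (t.1.val + t.2.val + s)}

/-- Z tiles: the interior tiles of even colour, and the weight-two blobs of even colour at the top and
bottom boundaries. -/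
abbrev ZTile (d e s : ℕ) :=
  {t : Fin (d + 1) × Fin (e + 1) // 0 < t.2.val ∧ t.2.val < e ∧ Even (t.1.val + t.2.val + s)}

/-- Supports of the X stabiliser generators. -/
def xStab (d e s : ℕ) (t : XTile d e s) : Qubit d e → ZMod 2 := tile d e t.1.1 t.1.2

/-- Supports of the Z stabiliser generators. -/
def zStab (d e s : ℕ) (t : ZTile d e s) : Qubit d e → ZMod 2 := tile d e t.1.1 t.1.2

/-- Support of the logical X operator: the bottom row. -/
def logicalX (d e : ℕ) : Qubit d e → ZMod 2 := fun q => if q.1.val + 1 = d then 1 else 0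

/-- Support of the logical Z operator: the leftmost column. -/
def logicalZ (d e : ℕ) : Qubit d e → ZMod 2 := fun q => if q.2.val = 0 then 1 else 0

/-- The defining properties of the encoder of a CSS code with one logical qubit, given by the supports
of its X and Z stabiliser generators and of its logical operators: `E` is an isometry onto the
subspace fixed by all stabilisers, and intertwines the logical operators with `X` and `Z`. -/
structure IsEncoder {ι τ σ : Type} [Fintype ι] [DecidableEq ι] (gX : τ → ι → ZMod 2)
    (gZ : σ → ι → ZMod 2) (lX lZ : ι → ZMod 2) (E : QMap (Fin 1) ι) : Prop where
  isometry : Eᴴ * E = 1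
  stabX : ∀ t, pauliX (gX t) * E = E
  stabZ : ∀ t, pauliZ (gZ t) * E = E
  range : ∀ ψ : (ι → ZMod 2) → ℂ, (∀ t, pauliX (gX t) *ᵥ ψ = ψ) → (∀ t, pauliZ (gZ t) *ᵥ ψ = ψ) →
    ∃ φ : (Fin 1 → ZMod 2) → ℂ, ψ = E *ᵥ φ
  logX : pauliX lX * E = E * pauliX 1
  logZ : pauliZ lZ * E = E * pauliZ 1

/-- The map that sends `|x⟩` to `2^(-|τ|/2) ∑_c |x ℓ + ∑_t c_t g_t⟩`. It is the normalised ZX diagram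
with a Z spider for the input and for every generator `t` (the bits `x` and `c t`), wired to an
X spider (a parity constraint) at every output qubit in the support of `ℓ` and of `g t`. -/
noncomputable def cssDiagram {ι τ : Type} [Fintype ι] [DecidableEq ι] [Fintype τ] [DecidableEq τ]
    (g : τ → ι → ZMod 2) (ℓ : ι → ZMod 2) : QMap (Fin 1) ι :=
  fun y x => (1 / (√2 : ℝ) : ℂ) ^ Fintype.card τ *
    ∑ c : τ → ZMod 2, if y = x 0 • ℓ + ∑ t, c t • g t then 1 else 0

/-- The encoder of the patch, in its X-representation. -/
noncomputable def encoder (d e s : ℕ) : QMap (Fin 1) (Qubit d e) :=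
  cssDiagram (xStab d e s) (logicalX d e)

/-- The Z-representation of the encoder: the diagram of the Z stabilisers and the logical Z operator,
with the roles of X and Z spiders exchanged. -/
noncomputable def zEncoder (d e s : ℕ) : QMap (Fin 1) (Qubit d e) :=
  hadamard (Qubit d e) * cssDiagram (zStab d e s) (logicalZ d e) * hadamard (Fin 1)

/-! ### Pairs of patches -/

/-- The qubits of two horizontally adjacent patches form one wide patch. -/
def sideBySide (d e₁ e₂ : ℕ) : Qubit d e₁ ⊕ Qubit d e₂ ≃ Qubit d (e₁ + e₂) :=
  (Equiv.prodSumDistrib (Fin d) (Fin e₁) (Fin e₂)).symm.trans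
    ((Equiv.refl (Fin d)).prodCongr finSumFinEquiv)

/-- The qubits of two vertically stacked patches form one tall patch. -/
def stacked (d₁ d₂ e : ℕ) : Qubit d₁ e ⊕ Qubit d₂ e ≃ Qubit (d₁ + d₂) e :=
  (Equiv.sumProdDistrib (Fin d₁) (Fin d₂) (Fin e)).symm.trans
    (finSumFinEquiv.prodCongr (Equiv.refl (Fin e)))

/-- The encoder of two independent patches next to each other, both coloured as in the wide patch. -/
noncomputable def sideBySideEncoder (d e₁ e₂ s : ℕ) : QMap (Fin 2) (Qubit d (e₁ + e₂)) :=
  tensor twoQubits (sideBySide d e₁ e₂) (encoder d e₁ s) (encoder d e₂ (s + e₁))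

/-- The encoder of two independent patches, one above the other, both coloured as in the tall
patch. -/
noncomputable def stackedEncoder (d₁ d₂ e s : ℕ) : QMap (Fin 2) (Qubit (d₁ + d₂) e) :=
  tensor twoQubits (stacked d₁ d₂ e) (encoder d₁ e s) (encoder d₂ e (s + d₁))

/-! ### Physical operations -/

/-- Rows of the X blobs at the right boundary of a patch with `d` rows and `e₁` columns. -/
def zSplitTiles (d e₁ s : ℕ) : List (Fin (d + 1)) :=
  (List.finRange (d + 1)).filter fun a => 0 < a.val ∧ a.val < d ∧ Odd (a.val + e₁ + s)

/-- The physical Z-split with outcomes `j`: inside a patch with `e₁ + e₂` columns, measure `XX` along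
column number `e₁`, on each X blob that would lie at the right boundary of the left `e₁` columns. -/
noncomputable def physZSplit (d e₁ e₂ s : ℕ) (j : Fin (d + 1) → ZMod 2) :
    QMap (Qubit d (e₁ + e₂)) (Qubit d (e₁ + e₂)) :=
  ((zSplitTiles d e₁ s).map fun a : Fin (d + 1) =>
    proj (pauliX fun q => if q.2.val < e₁ then tile d (e₁ + e₂) a e₁ q else 0) (j a)).prod

/-- Columns of the Z blobs at the bottom boundary of a patch with `d₁` rows and `e` columns. -/
def xSplitTiles (d₁ e s : ℕ) : List (Fin (e + 1)) :=
  (List.finRange (e + 1)).filter fun b => 0 < b.val ∧ b.val < e ∧ Even (d₁ + b.val + s)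

/-- The physical X-split with outcomes `j`: inside a patch with `d₁ + d₂` rows, measure `ZZ` along
row number `d₁`, on each Z blob that would lie at the bottom boundary of the upper `d₁` rows. -/
noncomputable def physXSplit (d₁ d₂ e s : ℕ) (j : Fin (e + 1) → ZMod 2) :
    QMap (Qubit (d₁ + d₂) e) (Qubit (d₁ + d₂) e) :=
  ((xSplitTiles d₁ e s).map fun b : Fin (e + 1) =>
    proj (pauliZ fun q => if q.1.val < d₁ then tile (d₁ + d₂) e d₁ b q else 0) (j b)).prod

/-- Columns of the X tiles of the tall patch that straddle the boundary between its upper `d₁` rows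
and the rows below, including the X blobs at the left and right ends of this boundary. -/
def xMergeTiles (d₁ e s : ℕ) : List (Fin (e + 1)) :=
  (List.finRange (e + 1)).filter fun b => Odd (d₁ + b.val + s)

/-- The physical X-merge with outcomes `j`: measure all X stabilisers of the tall patch that straddle
the boundary between the two stacked patches. -/
noncomputable def physXMerge (d₁ d₂ e s : ℕ) (j : Fin (e + 1) → ZMod 2) :
    QMap (Qubit (d₁ + d₂) e) (Qubit (d₁ + d₂) e) :=
  ((xMergeTiles d₁ e s).map fun b : Fin (e + 1) => proj (pauliX (tile (d₁ + d₂) e d₁ b)) (j b)).prod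

/-- Rows of the Z tiles of the wide patch that straddle the boundary between its left `e₁` columns
and the columns to the right, including the Z blobs at the top and bottom ends of this boundary. -/
def zMergeTiles (d e₁ s : ℕ) : List (Fin (d + 1)) :=
  (List.finRange (d + 1)).filter fun a => Even (a.val + e₁ + s)

/-- The physical Z-merge with outcomes `j`: measure all Z stabilisers of the wide patch that straddle
the boundary between the two adjacent patches. -/
noncomputable def physZMerge (d e₁ e₂ s : ℕ) (j : Fin (d + 1) → ZMod 2) :
    QMap (Qubit d (e₁ + e₂)) (Qubit d (e₁ + e₂)) :=
  ((zMergeTiles d e₁ s).map fun a : Fin (d + 1) => proj (pauliZ (tile d (e₁ + e₂) a e₁)) (j a)).prod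

end LatticeSurgery

open LatticeSurgery

/-! Every encoder here is a uniform superposition over a coset: `cssMap g o` sends |x⟩ to the
normalised sum over o(x) + span g. For independent g it depends only on span g and on o modulo that
span (`cssMap_congr`), so an identity between such maps reduces to linear algebra over F₂ and a
count of generators.

Measuring X^u with outcome 0 appends u to the generators and costs a factor 1/√2
(`proj_pauliX_mul_cssMap`). Other outcomes reduce to this one because Z^v X^u Z^v = (-1)^(v·u) X^u,
and independence of the X generators allows the pairings of v with them to be prescribed
(`exists_dotProduct_xStab_eq`). The outer Z^v is the error correction; the inner one is absorbed by
the encoder or becomes a logical phase.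

In the Z-split, the measured blobs cut the X tiles on the seam into boundary blobs of the two
halves, and the wide bottom row is the sum of the two short ones. In the X-merge, the measured tiles
complete the generators of the two patches to those of the tall patch. The X tiles of a horizontal
strip add up to its two rows (`sum_tile_eq_rowVec_add`), so the two logical X operators become equal
modulo stabilisers, and the inner Z^v acts as Z^k on the upper logical qubit.

For the encoder itself, orthogonality, independence and |X| + |Z| + 1 = de give a CSS code
(`isCSSCode`). By dimension, the span of the X generators is the common kernel of the Z generators
and logical Z; this yields the range of the encoder and, by Fourier transform, the equality of its
two representations. Hadamards combined with transposition of the patch exchange X and Z, so X-split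
and Z-merge follow from Z-split and X-merge. -/

namespace LatticeSurgery

set_option linter.unusedSectionVars false

/-! ### Coset maps -/

section CosetMap

variable {ι κ τ τ' : Type} [Fintype ι] [DecidableEq ι] [Fintype τ] [DecidableEq τ]
  [Fintype τ'] [DecidableEq τ']

/-- The map sending `|x⟩` to `2^(-|τ|/2) ∑_c |o x + ∑_t c_t g_t⟩`. -/
noncomputable def cssMap (g : τ → ι → ZMod 2) (o : (κ → ZMod 2) → ι → ZMod 2) : QMap κ ι :=
  fun y x => (1 / (√2 : ℝ) : ℂ) ^ Fintype.card τ *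
    ∑ c : τ → ZMod 2, if y = o x + ∑ t, c t • g t then 1 else 0

lemma cssDiagram_eq_cssMap (g : τ → ι → ZMod 2) (ℓ : ι → ZMod 2) :
    cssDiagram g ℓ = cssMap g fun x => x 0 • ℓ := rfl

-- Independence means that each point of the coset is hit by exactly one coefficient vector c.
open Classical in
lemma cssMap_apply {g : τ → ι → ZMod 2} (hg : LinearIndependent (ZMod 2) g)
    (o : (κ → ZMod 2) → ι → ZMod 2) (y : ι → ZMod 2) (x : κ → ZMod 2) :
    cssMap g o y x = if y - o x ∈ Submodule.span (ZMod 2) (Set.range g) then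
      (1 / (√2 : ℝ) : ℂ) ^ Fintype.card τ else 0 := by
  unfold cssMap
  split_ifs with h
  · obtain ⟨c, hc⟩ := (Submodule.mem_span_range_iff_exists_fun (ZMod 2)).1 h
    rw [Finset.sum_eq_single c, if_pos (by rw [hc]; abel), mul_one]
    · intro c' _ hne
      refine if_neg fun h' => hne ?_
      have : ∑ t, c' t • g t = ∑ t, c t • g t := by rw [hc, h']; abel
      exact hg.fintypeLinearCombination_injective (by
        simpa [Fintype.linearCombination_apply] using this)
    · simp
  · rw [Finset.sum_eq_zero, mul_zero]
    intro c _
    refine if_neg fun h' => h ?_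
    rw [h', add_sub_cancel_left]
    exact (Submodule.mem_span_range_iff_exists_fun (ZMod 2)).2 ⟨c, rfl⟩

/-- Independence of g' is not assumed: its span contains that of g and has dimension at most |τ'| =
|τ|, which forces equal spans and hence independence. -/
lemma cssMap_congr {g : τ → ι → ZMod 2} {g' : τ' → ι → ZMod 2}
    (hg : LinearIndependent (ZMod 2) g) (hcard : Fintype.card τ' = Fintype.card τ)
    (hspan : ∀ t, g t ∈ Submodule.span (ZMod 2) (Set.range g'))
    {o o' : (κ → ZMod 2) → ι → ZMod 2}
    (ho : ∀ x, o x - o' x ∈ Submodule.span (ZMod 2) (Set.range g)) :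
    cssMap g' o' = cssMap g o := by
  have hle : Submodule.span (ZMod 2) (Set.range g) ≤ Submodule.span (ZMod 2) (Set.range g') :=
    Submodule.span_le.2 (by rintro _ ⟨t, rfl⟩; exact hspan t)
  have hfin := finrank_span_eq_card hg
  have hfin' : Module.finrank (ZMod 2) (Submodule.span (ZMod 2) (Set.range g')) ≤
      Fintype.card τ' := finrank_range_le_card g'
  have heq := Submodule.eq_of_le_of_finrank_le hle (by omega)
  have hg' : LinearIndependent (ZMod 2) g' := by
    rw [linearIndependent_iff_card_eq_finrank_span]
    change _ = Module.finrank (ZMod 2) (Submodule.span (ZMod 2) (Set.range g'))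
    rw [← heq]; omega
  ext y x
  classical
  rw [cssMap_apply hg, cssMap_apply hg', ← heq, hcard]
  have : y - o' x ∈ Submodule.span (ZMod 2) (Set.range g) ↔
      y - o x ∈ Submodule.span (ZMod 2) (Set.range g) := by
    rw [← Submodule.sub_mem_iff_left _ (ho x)]
    congr! 1
    have : y - o' x - (o x - o' x) = y - o x := by abel
    rw [this]
  simp only [this]

end CosetMap

/-! ### Pauli strings -/

section Pauli

variable {ι κ τ : Type} [Fintype ι] [DecidableEq ι] [Fintype τ] [DecidableEq τ]

lemma eq_zero_or_eq_one : ∀ a : ZMod 2, a = 0 ∨ a = 1 := by decide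

@[simp] lemma sgn_zero : sgn 0 = 1 := if_pos rfl

@[simp] lemma sgn_one : sgn 1 = -1 := by simp [sgn]

lemma sgn_add (a b : ZMod 2) : sgn (a + b) = sgn a * sgn b := by
  rcases eq_zero_or_eq_one a with rfl | rfl <;> rcases eq_zero_or_eq_one b with rfl | rfl <;>
    simp [CharTwo.add_self_eq_zero]

lemma sgn_mul_self (a : ZMod 2) : sgn a * sgn a = 1 := by
  rw [← sgn_add, CharTwo.add_self_eq_zero, sgn_zero]

lemma vec_add_self (z : ι → ZMod 2) : z + z = 0 := by
  ext; exact CharTwo.add_self_eq_zero _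

lemma eq_add_iff_add_eq (y x u : ι → ZMod 2) : y = x + u ↔ x = y + u := by
  constructor <;> rintro rfl <;> rw [add_assoc, vec_add_self, add_zero]

lemma pauli_mul_apply (u v : ι → ZMod 2) (A : QMap κ ι) (y : ι → ZMod 2) (x : κ → ZMod 2) :
    (pauli u v * A) y x = sgn (v ⬝ᵥ (y + u)) * A (y + u) x := by
  rw [Matrix.mul_apply, Finset.sum_eq_single (y + u)]
  · simp [pauli, add_assoc, vec_add_self, dotProduct]
  · intro z _ hz
    rw [pauli, if_neg, zero_mul]
    intro h; exact hz ((eq_add_iff_add_eq _ _ _).1 h)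
  · simp

lemma pauliX_mul_apply (u : ι → ZMod 2) (A : QMap κ ι) (y : ι → ZMod 2) (x : κ → ZMod 2) :
    (pauliX u * A) y x = A (y + u) x := by
  simp [pauliX, pauli_mul_apply]

lemma pauliZ_mul_apply (v : ι → ZMod 2) (A : QMap κ ι) (y : ι → ZMod 2) (x : κ → ZMod 2) :
    (pauliZ v * A) y x = sgn (v ⬝ᵥ y) * A y x := by
  simp [pauliZ, pauli_mul_apply]

lemma mul_pauliX_apply (u : ι → ZMod 2) (A : QMap ι κ) (y : κ → ZMod 2) (x : ι → ZMod 2) :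
    (A * pauliX u) y x = A y (x + u) := by
  rw [Matrix.mul_apply, Finset.sum_eq_single (x + u)] <;> simp +contextual [pauliX, pauli]

lemma mul_pauliZ_apply (v : ι → ZMod 2) (A : QMap ι κ) (y : κ → ZMod 2) (x : ι → ZMod 2) :
    (A * pauliZ v) y x = A y x * sgn (v ⬝ᵥ x) := by
  rw [Matrix.mul_apply, Finset.sum_eq_single x]
  · simp [pauliZ, pauli, dotProduct]
  · intro z _ hz
    simp [pauliZ, pauli, hz]
  · simp

lemma pauliZ_mul_self (v : ι → ZMod 2) : pauliZ v * pauliZ v = 1 := by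
  ext y x
  rw [pauliZ_mul_apply, Matrix.one_apply]
  split_ifs with h
  · simp [h, pauliZ, pauli, dotProduct, sgn_mul_self]
  · simp [h, pauliZ, pauli]

lemma proj_pauliX_eq_conj (u v : ι → ZMod 2) :
    proj (pauliX u) (v ⬝ᵥ u) = pauliZ v * proj (pauliX u) 0 * pauliZ v := by
  have h : pauliZ v * pauliX u * pauliZ v = sgn (v ⬝ᵥ u) • pauliX u := by
    ext y x
    rw [mul_pauliZ_apply, pauliZ_mul_apply, Matrix.smul_apply]
    by_cases h : y = x + u
    · simp only [pauliX, pauli, h, dotProduct_add, sgn_add, if_true, smul_eq_mul]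
      simp
      linear_combination sgn (v ⬝ᵥ u) * sgn_mul_self (v ⬝ᵥ x)
    · simp [pauliX, pauli, h]
  simp only [proj, Matrix.mul_smul, Matrix.smul_mul, mul_add, add_mul, mul_one, pauliZ_mul_self,
    sgn_zero, one_smul, h]

/-- One string v serves all outcomes at once, since the inner factors Z^v Z^v cancel. -/
lemma list_prod_proj_pauliX_eq_conj {β : Type} (L : List β) (u : β → ι → ZMod 2) (j : β → ZMod 2)
    (v : ι → ZMod 2) (hv : ∀ a ∈ L, v ⬝ᵥ u a = j a) :
    (L.map fun a => proj (pauliX (u a)) (j a)).prod =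
      pauliZ v * (L.map fun a => proj (pauliX (u a)) 0).prod * pauliZ v := by
  induction L with
  | nil => simp [pauliZ_mul_self]
  | cons a L ih =>
    simp only [List.map_cons, List.prod_cons]
    rw [ih fun b hb => hv b (by simp [hb]), ← hv a (by simp), proj_pauliX_eq_conj]
    simp only [Matrix.mul_assoc]
    rw [← Matrix.mul_assoc (pauliZ v) (pauliZ v), pauliZ_mul_self, Matrix.one_mul]

/-- A character that is trivial on the generators is constant on each coset, so Z^v acts as a phase
of the logical input alone. -/
lemma pauliZ_mul_cssMap (g : τ → ι → ZMod 2) (o : (κ → ZMod 2) → ι → ZMod 2) (v : ι → ZMod 2)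
    (hv : ∀ t, v ⬝ᵥ g t = 0) (y : ι → ZMod 2) (x : κ → ZMod 2) :
    (pauliZ v * cssMap g o) y x = cssMap g o y x * sgn (v ⬝ᵥ o x) := by
  rw [pauliZ_mul_apply]
  simp only [cssMap]
  rw [mul_left_comm, mul_assoc, Finset.mul_sum, Finset.sum_mul]
  congr 1
  refine Finset.sum_congr rfl fun c _ => ?_
  split_ifs with h
  · simp [h, dotProduct_add, dotProduct_sum, dotProduct_smul, hv]
  · simp

lemma inv_sqrt_two_sq : (1 / (√2 : ℝ) : ℂ) ^ 2 = 1 / 2 := by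
  rw [div_pow, one_pow, ← Complex.ofReal_pow, Real.sq_sqrt (by norm_num)]; norm_num

/-- The sum 1 + X^u is the sum over the coefficient of a new generator u. Of 1/2 = (1/√2)², one
factor normalises the enlarged family and the other remains. No independence is needed. -/
lemma proj_pauliX_mul_cssMap (g : τ → ι → ZMod 2) (o : (κ → ZMod 2) → ι → ZMod 2)
    (u : ι → ZMod 2) :
    proj (pauliX u) 0 * cssMap g o =
      (1 / (√2 : ℝ) : ℂ) • cssMap (fun t : Option τ => t.elim u g) o := by
  ext y x
  have hsum : ∀ f : (Option τ → ZMod 2) → ℂ,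
      ∑ c, f c = ∑ c : τ → ZMod 2, (f (fun t => t.elim 0 c) + f (fun t => t.elim 1 c)) := by
    intro f
    rw [← (Equiv.piOptionEquivProd (β := fun _ : Option τ => ZMod 2)).symm.sum_comp,
      Fintype.sum_prod_type, Finset.sum_comm]
    refine Finset.sum_congr rfl fun c _ => ?_
    have : ∀ F : ZMod 2 → ℂ, ∑ b, F b = F 0 + F 1 := Fin.sum_univ_two
    rw [this]
    congr 2 <;> (funext t; cases t <;> rfl)
  simp only [proj, sgn_zero, one_smul, Matrix.smul_mul, Matrix.add_mul, Matrix.one_mul,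
    Matrix.smul_apply, Matrix.add_apply, pauliX_mul_apply, smul_eq_mul]
  simp only [cssMap]
  rw [hsum, Finset.sum_add_distrib, Fintype.card_option, ← inv_sqrt_two_sq]
  simp only [Fintype.sum_option, Option.elim]
  have : ∀ c : τ → ZMod 2, (y + u = o x + ∑ t, c t • g t) ↔
      (y = o x + ((1 : ZMod 2) • u + ∑ t, c t • g t)) := by
    intro c
    rw [eq_comm, eq_add_iff_add_eq, one_smul, add_comm u, ← add_assoc]
  simp only [this, zero_smul, zero_add]
  ring

lemma exists_list_prod_proj_mul_cssMap {β : Type} (L : List β) (u : β → ι → ZMod 2)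
    (g : τ → ι → ZMod 2) (o : (κ → ZMod 2) → ι → ZMod 2) :
    ∃ (τ' : Type) (_ : Fintype τ') (_ : DecidableEq τ') (g' : τ' → ι → ZMod 2),
      Fintype.card τ' = Fintype.card τ + L.length ∧
      (∀ t, g t ∈ Set.range g') ∧ (∀ a ∈ L, u a ∈ Set.range g') ∧
      (L.map fun a => proj (pauliX (u a)) 0).prod * cssMap g o =
        (1 / (√2 : ℝ) : ℂ) ^ L.length • cssMap g' o := by
  induction L with
  | nil => exact ⟨τ, inferInstance, inferInstance, g, by simp⟩
  | cons a L ih =>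
    obtain ⟨τ', _, _, g', hc, hg, hu, h⟩ := ih
    refine ⟨Option τ', inferInstance, inferInstance, fun t => t.elim (u a) g', ?_, ?_, ?_, ?_⟩
    · simp [hc, add_assoc]
    · intro t
      obtain ⟨t', ht'⟩ := hg t
      exact ⟨some t', ht'⟩
    · intro b hb
      rcases List.mem_cons.1 hb with rfl | hb
      · exact ⟨none, rfl⟩
      · obtain ⟨t', ht'⟩ := hu b hb
        exact ⟨some t', ht'⟩
    · rw [List.map_cons, List.prod_cons, Matrix.mul_assoc, h, Matrix.mul_smul,
        proj_pauliX_mul_cssMap, smul_smul, List.length_cons, pow_succ]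

/-- Values on an independent family define a functional on its span; it extends to the whole space,
where every functional is a dot product. -/
lemma exists_dotProduct_eq {g : τ → ι → ZMod 2} (hg : LinearIndependent (ZMod 2) g)
    (f : τ → ZMod 2) : ∃ v : ι → ZMod 2, ∀ t, v ⬝ᵥ g t = f t := by
  obtain ⟨F, hF⟩ : ∃ F : (ι → ZMod 2) →ₗ[ZMod 2] ZMod 2, ∀ t, F (g t) = f t := by
    obtain ⟨F, hF⟩ := LinearMap.exists_extend ((Module.Basis.span hg).constr (ZMod 2) f)
    refine ⟨F, fun t => ?_⟩
    have := LinearMap.congr_fun hF (Module.Basis.span hg t)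
    rw [Module.Basis.constr_basis] at this
    rw [← this]
    simp [Module.Basis.span_apply]
  refine ⟨fun i => F (Pi.single i 1), fun t => ?_⟩
  rw [← hF, LinearMap.pi_apply_eq_sum_univ F (g t)]
  simp only [dotProduct, smul_eq_mul, mul_comm]
  refine Finset.sum_congr rfl fun i _ => ?_
  congr 2
  ext k
  simp [Pi.single_apply, eq_comm]

/-- Pairing a relation with m isolates the coefficient of ℓ. -/
lemma linearIndependent_option_of_dotProduct {g : τ → ι → ZMod 2}
    (hg : LinearIndependent (ZMod 2) g) {ℓ m : ι → ZMod 2} (hm : ∀ t, m ⬝ᵥ g t = 0)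
    (hl : m ⬝ᵥ ℓ = 1) :
    LinearIndependent (ZMod 2) fun t : Option τ => t.elim ℓ g := by
  rw [Fintype.linearIndependent_iff] at hg ⊢
  intro c hc
  simp only [Fintype.sum_option, Option.elim] at hc
  have h0 : c none = 0 := by
    have := congrArg (m ⬝ᵥ ·) hc
    simpa [dotProduct_add, dotProduct_sum, dotProduct_smul, hm, hl] using this
  rw [h0, zero_smul, zero_add] at hc
  rintro (_ | t)
  · exact h0
  · exact hg (fun t => c (some t)) hc t

end Pauli

/-! ### Hadamard gates -/

section Hadamard

variable {ι κ τ σ : Type} [Fintype ι] [DecidableEq ι] [Fintype κ] [DecidableEq κ]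
  [Fintype τ] [DecidableEq τ] [Fintype σ] [DecidableEq σ]

lemma inv_sqrt_two_pow_mul_two_pow (n : ℕ) : (1 / (√2 : ℝ) : ℂ) ^ (2 * n) * 2 ^ n = 1 := by
  rw [pow_mul, inv_sqrt_two_sq, ← mul_pow]; norm_num

lemma sgn_sum {β : Type} (s : Finset β) (f : β → ZMod 2) :
    sgn (∑ i ∈ s, f i) = ∏ i ∈ s, sgn (f i) := by
  classical
  induction s using Finset.induction_on with
  | empty => simp
  | insert a s ha ih => rw [Finset.sum_insert ha, Finset.prod_insert ha, sgn_add, ih]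

lemma sum_sgn_mul (a : ZMod 2) : ∑ b : ZMod 2, sgn (b * a) = if a = 0 then 2 else 0 := by
  have : ∑ b : ZMod 2, sgn (b * a) = sgn (0 * a) + sgn (1 * a) := Fin.sum_univ_two _
  rw [this]
  rcases eq_zero_or_eq_one a with rfl | rfl <;> norm_num

/-- Orthogonality of characters: the sum factors over the coordinates. -/
lemma sum_sgn_dotProduct (a : ι → ZMod 2) :
    ∑ c : ι → ZMod 2, sgn (c ⬝ᵥ a) = if a = 0 then 2 ^ Fintype.card ι else 0 := by
  simp only [dotProduct, sgn_sum]
  have h := Finset.prod_univ_sum (fun _ : ι => (Finset.univ : Finset (ZMod 2)))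
    fun i b => sgn (b * a i)
  rw [Fintype.piFinset_univ] at h
  rw [← h]
  simp only [sum_sgn_mul]
  split_ifs with h
  · simp [h]
  · obtain ⟨i, hi⟩ := Function.ne_iff.1 h
    exact Finset.prod_eq_zero (Finset.mem_univ i) (if_neg hi)

lemma hadamard_apply (y x : ι → ZMod 2) :
    hadamard ι y x = (1 / (√2 : ℝ) : ℂ) ^ Fintype.card ι * sgn (y ⬝ᵥ x) := by
  simp only [hadamard, dotProduct, sgn_sum, div_eq_mul_inv, Finset.prod_mul_distrib, one_mul,
    Finset.prod_const, Finset.card_univ]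
  rw [mul_comm]

lemma hadamard_mul_self : hadamard ι * hadamard ι = 1 := by
  ext y x
  rw [Matrix.mul_apply, Matrix.one_apply]
  have : ∀ z : ι → ZMod 2, hadamard ι y z * hadamard ι z x =
      (1 / (√2 : ℝ) : ℂ) ^ (2 * Fintype.card ι) * sgn (z ⬝ᵥ (y + x)) := by
    intro z
    rw [hadamard_apply, hadamard_apply, dotProduct_add, sgn_add, dotProduct_comm y z]
    ring
  simp only [this]
  rw [← Finset.mul_sum, sum_sgn_dotProduct]
  have h : y + x = 0 ↔ y = x := by
    rw [eq_comm, eq_add_iff_add_eq, zero_add, eq_comm]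
  simp only [h]
  split_ifs
  · exact inv_sqrt_two_pow_mul_two_pow _
  · simp

lemma hadamard_mul_pauliX (u : ι → ZMod 2) : hadamard ι * pauliX u = pauliZ u * hadamard ι := by
  ext y x
  rw [mul_pauliX_apply, pauliZ_mul_apply, hadamard_apply, hadamard_apply, dotProduct_add, sgn_add,
    dotProduct_comm u]
  ring

lemma hadamard_mul_pauliZ (v : ι → ZMod 2) : hadamard ι * pauliZ v = pauliX v * hadamard ι := by
  ext y x
  rw [mul_pauliZ_apply, pauliX_mul_apply, hadamard_apply, hadamard_apply, add_dotProduct, sgn_add]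
  ring

lemma pauliZ_eq_hadamard_conj (u : ι → ZMod 2) :
    pauliZ u = hadamard ι * pauliX u * hadamard ι := by
  rw [hadamard_mul_pauliX, Matrix.mul_assoc, hadamard_mul_self, Matrix.mul_one]

lemma proj_pauliZ_eq_hadamard_conj (u : ι → ZMod 2) (k : ZMod 2) :
    proj (pauliZ u) k = hadamard ι * proj (pauliX u) k * hadamard ι := by
  simp only [proj, pauliZ_eq_hadamard_conj, Matrix.mul_smul, Matrix.smul_mul, mul_add, add_mul,
    mul_one, hadamard_mul_self]

lemma list_prod_hadamard_conj {β : Type} (L : List β) (A : β → QMap ι ι) :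
    (L.map fun a => hadamard ι * A a * hadamard ι).prod =
      hadamard ι * (L.map A).prod * hadamard ι := by
  induction L with
  | nil => simp [hadamard_mul_self]
  | cons a L ih =>
    simp only [List.map_cons, List.prod_cons]
    rw [ih]
    simp only [Matrix.mul_assoc]
    rw [← Matrix.mul_assoc (hadamard ι) (hadamard ι), hadamard_mul_self, Matrix.one_mul]

lemma hadamard_mulVec_ketZ (n : ℕ) (b : ZMod 2) : hadamard (Fin n) *ᵥ ketZ n b = ketX n b := by
  ext y
  rw [Matrix.mulVec, dotProduct, Finset.sum_eq_single fun _ => b]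
  · simp [ketZ, ketX, hadamard, mul_comm]
  · intro z _ hz
    obtain ⟨i, hi⟩ := Function.ne_iff.1 hz
    rw [ketZ, Finset.prod_eq_zero (Finset.mem_univ i) (if_neg hi), mul_zero]
  · simp

lemma star_sgn (a : ZMod 2) : star (sgn a) = sgn a := by
  rcases eq_zero_or_eq_one a with rfl | rfl <;> simp

lemma star_ketZ (n : ℕ) (b : ZMod 2) : star (ketZ n b) = ketZ n b := by
  ext y
  simp only [ketZ, Pi.star_apply, star_prod]
  exact Finset.prod_congr rfl fun i _ => by split_ifs <;> simp

lemma star_ketX (n : ℕ) (b : ZMod 2) : star (ketX n b) = ketX n b := by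
  ext y
  simp only [ketX, Pi.star_apply, star_prod]
  refine Finset.prod_congr rfl fun i _ => ?_
  rw [star_div₀, star_sgn]
  simp

lemma hadamard_transpose : (hadamard ι)ᵀ = hadamard ι := by
  ext y x
  rw [Matrix.transpose_apply, hadamard_apply, hadamard_apply, dotProduct_comm]

lemma xSpider_eq_hadamard_conj (m n : ℕ) (α : ℝ) :
    xSpider m n α = hadamard (Fin n) * zSpider m n α * hadamard (Fin m) := by
  have h : ∀ b, Matrix.vecMulVec (ketX n b) (ketX m b) =
      hadamard (Fin n) * Matrix.vecMulVec (ketZ n b) (ketZ m b) * hadamard (Fin m) := by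
    intro b
    rw [Matrix.mul_vecMulVec, Matrix.vecMulVec_mul, hadamard_mulVec_ketZ,
      ← Matrix.mulVec_transpose, hadamard_transpose, hadamard_mulVec_ketZ]
  simp only [xSpider, zSpider, star_ketX, star_ketZ, h, Matrix.mul_add, Matrix.add_mul,
    Matrix.mul_smul, Matrix.smul_mul]

/-- The Fourier transform of a coset is supported on the annihilator of its direction, and the
offset turns into a character. -/
lemma hadamard_mul_cssMap_apply (g : τ → ι → ZMod 2) (o : (κ → ZMod 2) → ι → ZMod 2)
    (y : ι → ZMod 2) (x : κ → ZMod 2) :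
    (hadamard ι * cssMap g o) y x = if ∀ t, g t ⬝ᵥ y = 0 then
      (1 / (√2 : ℝ) : ℂ) ^ (Fintype.card ι + Fintype.card τ) * 2 ^ Fintype.card τ *
        sgn (y ⬝ᵥ o x) else 0 := by
  have h1 : ∀ c : τ → ZMod 2, y ⬝ᵥ (o x + ∑ t, c t • g t) = y ⬝ᵥ o x + c ⬝ᵥ fun t => g t ⬝ᵥ y := by
    intro c
    rw [dotProduct_add, dotProduct_sum]
    simp [dotProduct_comm y]
    rfl
  rw [Matrix.mul_apply]
  simp only [cssMap, hadamard_apply, Finset.mul_sum]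
  rw [Finset.sum_comm]
  simp only [mul_ite, mul_one, mul_zero, Finset.sum_ite_eq', Finset.mem_univ,
    if_true, h1, sgn_add]
  have h2 : ∀ c : τ → ZMod 2, (1 / (√2 : ℝ) : ℂ) ^ Fintype.card ι *
      (sgn (y ⬝ᵥ o x) * sgn (c ⬝ᵥ fun t => g t ⬝ᵥ y)) * (1 / (√2 : ℝ) : ℂ) ^ Fintype.card τ =
      (1 / (√2 : ℝ) : ℂ) ^ (Fintype.card ι + Fintype.card τ) * sgn (y ⬝ᵥ o x) *
        sgn (c ⬝ᵥ fun t => g t ⬝ᵥ y) := by intro c; ring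
  simp only [h2]
  rw [← Finset.mul_sum, sum_sgn_dotProduct]
  simp only [funext_iff, Pi.zero_apply]
  split_ifs <;> ring

end Hadamard

/-! ### CSS codes with one logical qubit -/

section CSS

variable {ι τ σ : Type} [Fintype ι] [DecidableEq ι]
  [Fintype τ] [DecidableEq τ] [Fintype σ] [DecidableEq σ]

/-- The supports `gX`, `gZ` of the stabiliser generators and `lX`, `lZ` of the logical operators form
a CSS code with one logical qubit. -/
structure IsCSSCode (gX : τ → ι → ZMod 2) (gZ : σ → ι → ZMod 2) (lX lZ : ι → ZMod 2) : Prop where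
  indepX : LinearIndependent (ZMod 2) gX
  indepZ : LinearIndependent (ZMod 2) gZ
  orth : ∀ t r, gZ r ⬝ᵥ gX t = 0
  orthX : ∀ r, gZ r ⬝ᵥ lX = 0
  orthZ : ∀ t, lZ ⬝ᵥ gX t = 0
  pairing : lZ ⬝ᵥ lX = 1
  card : Fintype.card τ + Fintype.card σ + 1 = Fintype.card ι

variable {gX : τ → ι → ZMod 2} {gZ : σ → ι → ZMod 2} {lX lZ : ι → ZMod 2}

/-- Orthogonality gives one inclusion. The rows gZ together with lZ are independent, so their kernel
has dimension |ι| - |σ| - 1 = |τ|, that of the span. -/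
lemma IsCSSCode.mem_span_iff (h : IsCSSCode gX gZ lX lZ) (y : ι → ZMod 2) :
    y ∈ Submodule.span (ZMod 2) (Set.range gX) ↔ (∀ r, gZ r ⬝ᵥ y = 0) ∧ lZ ⬝ᵥ y = 0 := by
  set A : Matrix (Option σ) ι (ZMod 2) := Matrix.of fun r : Option σ => r.elim lZ gZ with hA
  have hker : ∀ y, y ∈ A.mulVecLin.ker ↔ (∀ r, gZ r ⬝ᵥ y = 0) ∧ lZ ⬝ᵥ y = 0 := by
    intro y
    rw [LinearMap.mem_ker, Matrix.mulVecLin_apply, funext_iff, Option.forall, and_comm]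
    rfl
  have hle : Submodule.span (ZMod 2) (Set.range gX) ≤ A.mulVecLin.ker := by
    rw [Submodule.span_le]
    rintro _ ⟨t, rfl⟩
    exact (hker _).2 ⟨fun r => h.orth t r, h.orthZ t⟩
  have hrank : A.rank = Fintype.card σ + 1 := by
    have : LinearIndependent (ZMod 2) A.row :=
      linearIndependent_option_of_dotProduct h.indepZ (m := lX)
        (fun t => by rw [dotProduct_comm]; exact h.orthX t)
        (by rw [dotProduct_comm]; exact h.pairing)
    rw [this.rank_matrix, Fintype.card_option]
  have hdim := LinearMap.finrank_range_add_finrank_ker A.mulVecLin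
  rw [Module.finrank_fintype_fun_eq_card, ← h.card] at hdim
  have hspan := finrank_span_eq_card h.indepX
  rw [Matrix.rank] at hrank
  rw [Submodule.eq_of_le_of_finrank_le hle (by omega), hker]

lemma IsCSSCode.cssDiagram_apply (h : IsCSSCode gX gZ lX lZ) (y : ι → ZMod 2)
    (x : Fin 1 → ZMod 2) :
    cssDiagram gX lX y x = if (∀ r, gZ r ⬝ᵥ y = 0) ∧ lZ ⬝ᵥ y = x 0 then
      (1 / (√2 : ℝ) : ℂ) ^ Fintype.card τ else 0 := by
  classical
  rw [cssDiagram_eq_cssMap, cssMap_apply h.indepX, h.mem_span_iff]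
  simp only [dotProduct_sub, dotProduct_smul, h.orthX, h.pairing, mul_zero, sub_zero, smul_eq_mul,
    mul_one, sub_eq_zero]

lemma IsCSSCode.isEncoder (h : IsCSSCode gX gZ lX lZ) :
    IsEncoder gX gZ lX lZ (cssDiagram gX lX) where
  isometry := by
    ext x x'
    have hE : ∀ y : ι → ZMod 2, star (cssDiagram gX lX y x) =
        (1 / (√2 : ℝ) : ℂ) ^ Fintype.card τ *
          ∑ c : τ → ZMod 2, if y = x 0 • lX + ∑ t, c t • gX t then 1 else 0 := by
      intro y
      simp only [cssDiagram, star_mul', star_pow, star_sum]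
      congr 2
      · simp
      · ext c; split_ifs <;> simp
    rw [Matrix.mul_apply]
    simp only [Matrix.conjTranspose_apply, hE, mul_assoc, Finset.sum_mul]
    rw [← Finset.mul_sum, Finset.sum_comm]
    simp only [ite_mul, one_mul, zero_mul, Finset.sum_ite_eq', Finset.mem_univ, if_true]
    simp only [h.cssDiagram_apply, dotProduct_add, dotProduct_sum, dotProduct_smul, h.orthX, h.orth,
      h.orthZ, h.pairing, mul_zero, Finset.sum_const_zero, add_zero, implies_true, true_and,
      smul_eq_mul, mul_one]
    have hx : x 0 = x' 0 ↔ x = x' := by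
      rw [funext_iff, Fin.forall_fin_one]
    simp only [hx, Matrix.one_apply]
    split_ifs
    -- The coset has 2^|τ| points, each of squared amplitude 2^(-|τ|).
    · rw [Finset.sum_const, nsmul_eq_mul, Finset.card_univ, Fintype.card_fun, ZMod.card]
      push_cast
      linear_combination inv_sqrt_two_pow_mul_two_pow (Fintype.card τ)
    · simp
  stabX t := by
    ext y x
    rw [pauliX_mul_apply, h.cssDiagram_apply, h.cssDiagram_apply]
    simp only [dotProduct_add, h.orth, h.orthZ, add_zero]
  stabZ r := by
    ext y x
    rw [pauliZ_mul_apply, h.cssDiagram_apply]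
    split_ifs with hy
    · rw [hy.1 r, sgn_zero, one_mul]
    · simp
  range ψ hX hZ := by
    have hX' : ∀ t y, ψ (y + gX t) = ψ y := by
      intro t y
      have := congrFun (hX t) y
      -- The vector is viewed as a matrix with one column: `Empty → ZMod 2` has a single element, so
      -- the entry formulas for `QMap` apply.
      rwa [← Matrix.replicateCol_apply (ι := Empty → ZMod 2) (pauliX (gX t) *ᵥ ψ) y 0,
        Matrix.replicateCol_mulVec, pauliX_mul_apply] at this
    have hZ' : ∀ y, ψ y ≠ 0 → ∀ r, gZ r ⬝ᵥ y = 0 := by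
      intro y hy r
      have := congrFun (hZ r) y
      rw [← Matrix.replicateCol_apply (ι := Empty → ZMod 2) (pauliZ (gZ r) *ᵥ ψ) y 0,
        Matrix.replicateCol_mulVec, pauliZ_mul_apply, Matrix.replicateCol_apply] at this
      rcases eq_zero_or_eq_one (gZ r ⬝ᵥ y) with h0 | h1
      · exact h0
      · rw [h1, sgn_one] at this
        exact absurd (by linear_combination (-1 / 2 : ℂ) * this) hy
    have hspan : ∀ s ∈ Submodule.span (ZMod 2) (Set.range gX), ∀ y, ψ (y + s) = ψ y := by
      intro s hs
      induction hs using Submodule.span_induction with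
      | mem s hs => obtain ⟨t, rfl⟩ := hs; exact hX' t
      | zero => simp
      | add a b _ _ ha hb => intro y; rw [← add_assoc, hb, ha]
      | smul c a _ ha =>
        rcases eq_zero_or_eq_one c with rfl | rfl
        · simp
        · simpa using ha
    -- X-invariance makes ψ constant on cosets of span gX and Z-invariance confines it to the two
    -- cosets of 0 and lX. Its values there, divided by the amplitude of the encoder, give φ.
    refine ⟨fun x => (1 / (√2 : ℝ) : ℂ)⁻¹ ^ Fintype.card τ * ψ (x 0 • lX), ?_⟩
    ext y
    rw [Matrix.mulVec, dotProduct, Finset.sum_eq_single fun _ => lZ ⬝ᵥ y]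
    · rw [h.cssDiagram_apply]
      split_ifs with hy
      · rw [← mul_assoc, ← mul_pow, mul_inv_cancel₀ (by simp), one_pow, one_mul]
        have hmem : y - (lZ ⬝ᵥ y) • lX ∈ Submodule.span (ZMod 2) (Set.range gX) := by
          rw [h.mem_span_iff]
          simp [dotProduct_sub, dotProduct_smul, h.orthX, h.pairing, hy.1]
        rw [← hspan _ hmem y, add_sub, vec_add_self, zero_sub,
          neg_eq_of_add_eq_zero_left (vec_add_self _)]
      · rw [zero_mul]
        by_contra hne
        exact hy ⟨hZ' y hne, rfl⟩
    · intro x _ hx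
      rw [h.cssDiagram_apply, if_neg, zero_mul]
      rintro ⟨_, h'⟩
      exact hx (by ext i; rw [Fin.fin_one_eq_zero i, h'])
    · simp
  logX := by
    have key : ∀ y x, (pauliX lX * cssDiagram gX lX) y x = cssDiagram gX lX y (x + 1) := by
      intro y x
      rw [pauliX_mul_apply, h.cssDiagram_apply, h.cssDiagram_apply]
      simp only [dotProduct_add, h.orthX, h.pairing, add_zero, Pi.add_apply, Pi.one_apply]
      have : ∀ a b : ZMod 2, a + 1 = b ↔ a = b + 1 := by decide
      simp only [this]
    ext y x
    exact (key y x).trans (mul_pauliX_apply 1 (cssDiagram gX lX) y x).symm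
  logZ := by
    have key : ∀ y x, (pauliZ lZ * cssDiagram gX lX) y x =
        cssDiagram gX lX y x * sgn ((1 : Fin 1 → ZMod 2) ⬝ᵥ x) := by
      intro y x
      rw [pauliZ_mul_apply, h.cssDiagram_apply]
      split_ifs with hy
      · rw [hy.2, mul_comm]
        simp [dotProduct]
      · simp
    ext y x
    exact (key y x).trans (mul_pauliZ_apply 1 (cssDiagram gX lX) y x).symm

/-- Both sides are supported where gZ annihilates y and lZ · y = x: on the right, the output
Hadamards give the first condition and the sum over the logical bit the second. The amplitudes agree
by |ι| = |τ| + |σ| + 1. -/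
lemma IsCSSCode.cssDiagram_eq_hadamard_conj (h : IsCSSCode gX gZ lX lZ) :
    cssDiagram gX lX = hadamard ι * cssDiagram gZ lZ * hadamard (Fin 1) := by
  ext y x
  rw [Matrix.mul_apply, h.cssDiagram_apply]
  simp only [cssDiagram_eq_cssMap gZ, hadamard_mul_cssMap_apply, hadamard_apply]
  by_cases hy : ∀ r, gZ r ⬝ᵥ y = 0
  · simp only [hy, implies_true, if_true, true_and]
    have h1 : ∀ w : Fin 1 → ZMod 2, (1 / (√2 : ℝ) : ℂ) ^ (Fintype.card ι + Fintype.card σ) *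
        2 ^ Fintype.card σ * sgn (y ⬝ᵥ w 0 • lZ) *
        ((1 / (√2 : ℝ) : ℂ) ^ Fintype.card (Fin 1) * sgn (w ⬝ᵥ x)) =
        (1 / (√2 : ℝ) : ℂ) ^ (Fintype.card ι + Fintype.card σ + 1) * 2 ^ Fintype.card σ *
          sgn (w ⬝ᵥ fun _ => lZ ⬝ᵥ y + x 0) := by
      intro w
      have : (w ⬝ᵥ fun _ => lZ ⬝ᵥ y + x 0) = y ⬝ᵥ w 0 • lZ + w ⬝ᵥ x := by
        rw [dotProduct_smul, dotProduct_comm y]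
        simp [dotProduct, mul_add]
      rw [this, sgn_add, Fintype.card_fin]
      ring
    simp only [h1]
    rw [← Finset.mul_sum, sum_sgn_dotProduct]
    have h2 : (fun _ : Fin 1 => lZ ⬝ᵥ y + x 0) = 0 ↔ lZ ⬝ᵥ y = x 0 := by
      rw [funext_iff, Fin.forall_fin_one]
      exact CharTwo.add_eq_zero
    simp only [h2]
    split_ifs
    · rw [← h.card, Fintype.card_fin]
      linear_combination (-(1 / (√2 : ℝ) : ℂ) ^ Fintype.card τ) *
        inv_sqrt_two_pow_mul_two_pow (Fintype.card σ + 1)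
    · simp
  · simp [hy]

end CSS

/-! ### Tensor products -/

section Tensor

variable {ι₁ ι₂ ι κ₁ κ₂ κ χ₁ χ₂ χ τ₁ τ₂ : Type} [Fintype ι₁] [DecidableEq ι₁]
  [Fintype ι₂] [DecidableEq ι₂]
  [Fintype ι] [DecidableEq ι] [Fintype κ₁] [DecidableEq κ₁] [Fintype κ₂] [DecidableEq κ₂]
  [Fintype κ] [DecidableEq κ] [Fintype τ₁] [DecidableEq τ₁] [Fintype τ₂] [DecidableEq τ₂]

/-- The bit string on a joint register that restricts to `v` and `w` on the two parts. -/
def glue (φ : ι₁ ⊕ ι₂ ≃ ι) (v : ι₁ → ZMod 2) (w : ι₂ → ZMod 2) : ι → ZMod 2 :=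
  fun i => Sum.elim v w (φ.symm i)

@[simp] lemma glue_inl (φ : ι₁ ⊕ ι₂ ≃ ι) (v : ι₁ → ZMod 2) (w : ι₂ → ZMod 2) (i : ι₁) :
    glue φ v w (φ (.inl i)) = v i := by simp [glue]

@[simp] lemma glue_inr (φ : ι₁ ⊕ ι₂ ≃ ι) (v : ι₁ → ZMod 2) (w : ι₂ → ZMod 2) (i : ι₂) :
    glue φ v w (φ (.inr i)) = w i := by simp [glue]

lemma eq_iff_restrict (φ : ι₁ ⊕ ι₂ ≃ ι) (y z : ι → ZMod 2) :
    y = z ↔ (∀ i, y (φ (.inl i)) = z (φ (.inl i))) ∧ ∀ i, y (φ (.inr i)) = z (φ (.inr i)) := by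
  rw [funext_iff, φ.symm.forall_congr_left, Sum.forall]
  rfl

lemma dotProduct_eq_restrict (φ : ι₁ ⊕ ι₂ ≃ ι) (y z : ι → ZMod 2) :
    y ⬝ᵥ z = (fun i => y (φ (.inl i))) ⬝ᵥ (fun i => z (φ (.inl i))) +
      (fun i => y (φ (.inr i))) ⬝ᵥ fun i => z (φ (.inr i)) := by
  simp only [dotProduct]
  rw [← φ.sum_comp, Fintype.sum_sum_type]

/-- Pairs of bit strings are bit strings on the joint register. -/
def glueEquiv (φ : ι₁ ⊕ ι₂ ≃ ι) : (ι₁ → ZMod 2) × (ι₂ → ZMod 2) ≃ (ι → ZMod 2) where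
  toFun p := glue φ p.1 p.2
  invFun y := (fun i => y (φ (.inl i)), fun i => y (φ (.inr i)))
  left_inv p := by ext <;> simp
  right_inv y := by rw [eq_iff_restrict φ]; simp

lemma tensor_mul_tensor (φ : ι₁ ⊕ ι₂ ≃ ι) (ψ : κ₁ ⊕ κ₂ ≃ κ) (ω : χ₁ ⊕ χ₂ ≃ χ)
    (A : QMap κ₁ χ₁) (B : QMap κ₂ χ₂) (C : QMap ι₁ κ₁) (D : QMap ι₂ κ₂) :
    tensor ψ ω A B * tensor φ ψ C D = tensor φ ω (A * C) (B * D) := by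
  ext y x
  rw [Matrix.mul_apply, ← (glueEquiv ψ).sum_comp, Fintype.sum_prod_type]
  simp only [tensor, glueEquiv, Equiv.coe_fn_mk, glue_inl, glue_inr, Matrix.mul_apply]
  rw [Finset.sum_mul_sum]
  refine Finset.sum_congr rfl fun _ _ => Finset.sum_congr rfl fun _ _ => ?_
  ring

lemma tensor_hadamard (φ : ι₁ ⊕ ι₂ ≃ ι) :
    tensor φ φ (hadamard ι₁) (hadamard ι₂) = hadamard ι := by
  ext y x
  simp only [tensor, hadamard]
  rw [← φ.prod_comp, Fintype.prod_sum_type]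

lemma tensor_cssDiagram (ψ : ι₁ ⊕ ι₂ ≃ ι) (g₁ : τ₁ → ι₁ → ZMod 2) (g₂ : τ₂ → ι₂ → ZMod 2)
    (ℓ₁ : ι₁ → ZMod 2) (ℓ₂ : ι₂ → ZMod 2) :
    tensor twoQubits ψ (cssDiagram g₁ ℓ₁) (cssDiagram g₂ ℓ₂) =
      cssMap (Sum.elim (fun t => glue ψ (g₁ t) 0) fun t => glue ψ 0 (g₂ t))
        fun x => x 0 • glue ψ ℓ₁ 0 + x 1 • glue ψ 0 ℓ₂ := by
  ext y x
  simp only [tensor, cssDiagram, cssMap]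
  rw [mul_mul_mul_comm, Finset.sum_mul_sum, ← pow_add, Fintype.card_sum,
    ← (Equiv.sumArrowEquivProdArrow τ₁ τ₂ (ZMod 2)).symm.sum_comp, Fintype.sum_prod_type]
  congr 1
  refine Finset.sum_congr rfl fun c₁ _ => Finset.sum_congr rfl fun c₂ _ => ?_
  rw [ite_zero_mul_ite_zero, mul_one]
  congr 1
  rw [eq_iff_restrict ψ y, funext_iff, funext_iff]
  have h0 : twoQubits (Sum.inl 0) = 0 := rfl
  have h1 : twoQubits (Sum.inr 0) = 1 := rfl
  simp [Equiv.sumArrowEquivProdArrow, h0, h1]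

lemma linearIndependent_glue (ψ : ι₁ ⊕ ι₂ ≃ ι) {g₁ : τ₁ → ι₁ → ZMod 2} {g₂ : τ₂ → ι₂ → ZMod 2}
    (h₁ : LinearIndependent (ZMod 2) g₁) (h₂ : LinearIndependent (ZMod 2) g₂) :
    LinearIndependent (ZMod 2) (Sum.elim (fun t => glue ψ (g₁ t) 0) fun t => glue ψ 0 (g₂ t)) := by
  rw [Fintype.linearIndependent_iff] at h₁ h₂ ⊢
  intro c hc
  rw [eq_iff_restrict ψ] at hc
  rintro (t | t)
  · refine h₁ (fun t => c (.inl t)) ?_ t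
    ext i
    simpa using hc.1 i
  · refine h₂ (fun t => c (.inr t)) ?_ t
    ext i
    simpa using hc.2 i

end Tensor

/-! ### Tiles -/

/-- The two positions next to the line `a`. -/
def seg (a r : ℕ) : ZMod 2 := if r = a ∨ r + 1 = a then 1 else 0

/-- The indicator of row `r`. -/
def rowVec (d e r : ℕ) : Qubit d e → ZMod 2 := fun q => if q.1.val = r then 1 else 0

lemma tile_eq_seg_mul (d e a b : ℕ) :
    tile d e a b = fun q => seg a q.1 * seg b q.2 := by
  ext q
  simp only [tile, seg, ite_zero_mul_ite_zero, mul_one]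

lemma tile_swap (d e a b : ℕ) (q : Qubit d e) : tile d e a b q = tile e d b a q.swap := by
  simp only [tile_eq_seg_mul, Prod.fst_swap, Prod.snd_swap, mul_comm]

lemma logicalX_eq_rowVec {d : ℕ} (hd : 0 < d) (e : ℕ) : logicalX d e = rowVec d e (d - 1) := by
  ext q
  exact if_congr (by omega) rfl rfl

/-! ### Orthogonality and independence of the generators -/

lemma dotProduct_mul_mul {α β : Type} [Fintype α] [Fintype β] (f f' : α → ZMod 2)
    (g g' : β → ZMod 2) :
    (fun q : α × β => f q.1 * g q.2) ⬝ᵥ (fun q => f' q.1 * g' q.2) = (f ⬝ᵥ f') * (g ⬝ᵥ g') := by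
  simp only [dotProduct, Fintype.sum_prod_type, Finset.sum_mul_sum]
  exact Finset.sum_congr rfl fun _ _ => Finset.sum_congr rfl fun _ _ => by ring

lemma sum_seg_mul {d a : ℕ} (h0 : 0 < a) (h1 : a < d) (f : ℕ → ZMod 2) :
    ∑ r : Fin d, seg a r * f r = f a + f (a - 1) := by
  have h : ∀ r : ℕ, seg a r = (if r = a then 1 else 0) + if r = a - 1 then 1 else 0 := by
    intro r
    unfold seg
    split_ifs <;> first | omega | simp
  rw [Fin.sum_univ_eq_sum_range (fun r => seg a r * f r) d]
  simp only [h, add_mul, ite_mul, one_mul, zero_mul, Finset.sum_add_distrib, Finset.sum_ite_eq',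
    Finset.mem_range]
  rw [if_pos h1, if_pos (by omega)]

lemma sum_seg_mul_seg {d a : ℕ} (h0 : 0 < a) (h1 : a < d) (a' : ℕ) :
    (fun r : Fin d => seg a r) ⬝ᵥ (fun r => seg a' r) =
      if a' = a + 1 ∨ a' + 1 = a then 1 else 0 := by
  rw [dotProduct, sum_seg_mul h0 h1 (seg a')]
  unfold seg
  split_ifs <;> first | omega | rfl

lemma zStab_dotProduct_xStab {d e s : ℕ} (t : XTile d e s) (r : ZTile d e s) :
    zStab d e s r ⬝ᵥ xStab d e s t = 0 := by
  obtain ⟨⟨a, b⟩, h0, h1, hodd⟩ := t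
  obtain ⟨⟨a', b'⟩, h0', h1', heven⟩ := r
  simp only [zStab, xStab, tile_eq_seg_mul]
  rw [dotProduct_mul_mul (fun r : Fin d => seg a' r) (fun r => seg a r) (fun c : Fin e => seg b' c)
    fun c => seg b c, sum_seg_mul_seg h0' h1', dotProduct_comm, sum_seg_mul_seg h0 h1,
    -- An odd overlap needs tiles that are adjacent in both directions, that is diagonal neighbours,
    -- and these have the same colour.
    ite_zero_mul_ite_zero, if_neg]
  rintro ⟨h2, h3⟩
  simp only [Nat.odd_iff, Nat.even_iff] at hodd heven h2 h3
  omega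

lemma sum_seg {d a : ℕ} (h0 : 0 < a) (h1 : a < d) :
    (fun _ : Fin d => (1 : ZMod 2)) ⬝ᵥ (fun r => seg a r) = 0 := by
  rw [dotProduct_comm, dotProduct, sum_seg_mul h0 h1 fun _ => 1]
  rfl

lemma logicalZ_dotProduct_xStab {d e s : ℕ} (t : XTile d e s) :
    logicalZ d e ⬝ᵥ xStab d e s t = 0 := by
  obtain ⟨⟨a, b⟩, h0, h1, _⟩ := t
  have : logicalZ d e = fun q => 1 * if q.2.val = 0 then 1 else 0 := by ext; simp [logicalZ]
  rw [this, xStab, tile_eq_seg_mul,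
    dotProduct_mul_mul (fun _ : Fin d => 1) (fun r => seg a r)
      (fun c : Fin e => if c.val = 0 then 1 else 0) fun c => seg b c,
    sum_seg h0 h1, zero_mul]

lemma zStab_dotProduct_logicalX {d e s : ℕ} (r : ZTile d e s) :
    zStab d e s r ⬝ᵥ logicalX d e = 0 := by
  obtain ⟨⟨a, b⟩, h0, h1, _⟩ := r
  have : logicalX d e = fun q => (if q.1.val + 1 = d then 1 else 0) * 1 := by ext; simp [logicalX]
  rw [this, zStab, tile_eq_seg_mul, dotProduct_comm,
    dotProduct_mul_mul (fun r : Fin d => if r.val + 1 = d then 1 else 0) (fun r => seg a r)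
      (fun _ : Fin e => 1) fun c => seg b c,
    sum_seg h0 h1, mul_zero]

lemma logicalZ_dotProduct_logicalX {d e : ℕ} (hd : 0 < d) (he : 0 < e) :
    logicalZ d e ⬝ᵥ logicalX d e = 1 := by
  rw [dotProduct, Finset.sum_eq_single (⟨d - 1, by omega⟩, ⟨0, he⟩)]
  · simp [logicalZ, logicalX, Nat.sub_add_cancel hd]
  · rintro ⟨r, c⟩ _ hne
    simp only [logicalZ, logicalX, ite_zero_mul_ite_zero]
    refine if_neg fun h => hne ?_
    ext <;> simp <;> omega
  · simp

/-- Elimination from the top row: a tile on line a + 1 is the only X tile on that line through a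
chosen qubit of row a, and the coefficients of tiles on line a already vanish. -/
lemma linearIndependent_xStab (d : ℕ) {e : ℕ} (he : 0 < e) (s : ℕ) :
    LinearIndependent (ZMod 2) (xStab d e s) := by
  rw [Fintype.linearIndependent_iff]
  intro c hc
  suffices ∀ a, ∀ t : XTile d e s, t.1.1.val = a → c t = 0 from fun t => this _ t rfl
  intro a
  induction a with
  | zero => intro t ht; exact absurd t.2.1 (by omega)
  | succ a ih =>
    intro t ht
    obtain ⟨⟨⟨a', ha'⟩, ⟨b, hb⟩⟩, h0, h1, hodd⟩ := t
    simp only at ht h0 h1 hodd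
    subst ht
    -- A column met by the tile; for the blob at b = e only b - 1 exists.
    obtain ⟨k, hk, hkb⟩ : ∃ k, k < e ∧ (b = k ∨ b = k + 1) := by
      rcases lt_or_ge b e with h | h
      · exact ⟨b, h, .inl rfl⟩
      · exact ⟨b - 1, by omega, .inr (by omega)⟩
    have hq := congrFun hc (⟨a, by omega⟩, ⟨k, hk⟩)
    rw [Finset.sum_apply, Finset.sum_eq_single ⟨(⟨a + 1, ha'⟩, ⟨b, hb⟩), h0, h1, hodd⟩] at hq
    · have : k = b ∨ k + 1 = b := by omega
      simpa [xStab, tile, this] using hq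
    · rintro ⟨⟨⟨a', ha'⟩, ⟨b', hb'⟩⟩, h0', h1', hodd'⟩ _ hne
      rcases eq_or_ne a' a with rfl | h
      · rw [ih _ rfl, zero_smul]; rfl
      · have : ¬ ((a = a' ∨ a + 1 = a') ∧ (k = b' ∨ k + 1 = b')) := by
          rintro ⟨h2, h3⟩
          obtain rfl : a' = a + 1 := by omega
          simp only [Nat.odd_iff] at hodd hodd'
          obtain rfl : b' = b := by omega
          exact hne rfl
        simp [xStab, tile, this]
    · simp

/-- Transposition turns Z tiles into X tiles. -/
def zTileEquiv (d e s : ℕ) : ZTile d e s ≃ XTile e d (s + 1) :=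
  (Equiv.prodComm _ _).subtypeEquiv fun t => by
    simp only [Equiv.prodComm_apply, Prod.fst_swap, Prod.snd_swap, Nat.even_iff, Nat.odd_iff]
    omega

lemma zStab_apply (d e s : ℕ) (t : ZTile d e s) (q : Qubit d e) :
    zStab d e s t q = xStab e d (s + 1) (zTileEquiv d e s t) q.swap := by
  rw [zStab, tile_swap]; rfl

lemma linearIndependent_zStab {d : ℕ} (hd : 0 < d) (e s : ℕ) :
    LinearIndependent (ZMod 2) (zStab d e s) := by
  have h := linearIndependent_xStab e hd (s + 1)
  rw [Fintype.linearIndependent_iff] at h ⊢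
  intro c hc t
  have := h (fun t => c ((zTileEquiv d e s).symm t)) ?_ (zTileEquiv d e s t)
  · simpa using this
  · ext q
    rw [← (zTileEquiv d e s).sum_comp]
    have := congrFun hc q.swap
    simpa [zStab_apply] using this

/-! ### Rows -/

/-- Each qubit of the strip lies in two consecutive tiles of it, exactly one of which has odd
colour. -/
lemma sum_tile_eq_rowVec_add (d e s : ℕ) {a : ℕ} (h0 : 0 < a) :
    ∑ b : Fin (e + 1), (if Odd (a + b.val + s) then tile d e a b else 0) =
      rowVec d e (a - 1) + rowVec d e a := by
  ext ⟨r, k⟩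
  have h1 : (rowVec d e (a - 1) + rowVec d e a) (r, k) = seg a r := by
    simp only [rowVec, Pi.add_apply, seg]
    split_ifs <;> first | omega | simp
  obtain ⟨b, hb, hodd⟩ : ∃ b, (b = k.val ∨ b = k.val + 1) ∧ Odd (a + b + s) := by
    simp only [Nat.odd_iff]
    by_cases h : (a + k.val + s) % 2 = 1
    · exact ⟨k, .inl rfl, h⟩
    · exact ⟨k + 1, .inr rfl, by omega⟩
  rw [h1, Finset.sum_apply, Finset.sum_eq_single ⟨b, by omega⟩]
  · rw [if_pos hodd, tile_eq_seg_mul]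
    have : seg b k = 1 := if_pos (by omega)
    simp [this]
  · rintro ⟨b', hb'⟩ _ hne
    split_ifs with h
    · rw [tile_eq_seg_mul]
      have : seg b' k = 0 := by
        refine if_neg fun h' => hne ?_
        simp only [Nat.odd_iff] at h hodd
        ext
        simp only
        omega
      simp [this]
    · rfl
  · simp

lemma rowVec_sub_mem_span {d e s r r' : ℕ} (h : r ≤ r') (h' : r' < d) :
    rowVec d e r' - rowVec d e r ∈ Submodule.span (ZMod 2) (Set.range (xStab d e s)) := by
  induction r', h using Nat.le_induction with
  | base => simp
  | succ a _ ih =>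
    have hmem : rowVec d e a + rowVec d e (a + 1) ∈
        Submodule.span (ZMod 2) (Set.range (xStab d e s)) := by
      have := sum_tile_eq_rowVec_add d e s (Nat.succ_pos a)
      rw [Nat.succ_eq_add_one, Nat.add_sub_cancel] at this
      rw [← this]
      refine Submodule.sum_mem _ fun b _ => ?_
      split_ifs with hodd
      · exact Submodule.subset_span
          ⟨⟨(⟨a + 1, by omega⟩, b), Nat.succ_pos a, h', hodd⟩, rfl⟩
      · exact Submodule.zero_mem _
    have := Submodule.add_mem _ hmem (ih (by omega))
    convert this using 1
    linear_combination (exp := 1) -(vec_add_self (rowVec d e a))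

/-! ### Counting tiles -/

lemma sum_map_filter_finRange {M : Type} [AddCommMonoid M] (n : ℕ) (p : Fin n → Prop)
    [DecidablePred p] (f : Fin n → M) :
    (((List.finRange n).filter p).map f).sum = ∑ i, if p i then f i else 0 := by
  rw [Fin.sum_univ_def]
  generalize List.finRange n = L
  induction L with
  | nil => rfl
  | cons a L ih => by_cases h : p a <;> simp [h, ih]

lemma length_filter_finRange (n : ℕ) (p : Fin n → Prop) [DecidablePred p] :
    ((List.finRange n).filter p).length = ∑ i, if p i then 1 else 0 := by
  rw [← sum_map_filter_finRange]
  simp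

/-- The number of tiles of odd colour in a strip of length `e` with colour phase `p`. -/
def stripCount (e p : ℕ) : ℕ := ∑ b ∈ Finset.range (e + 1), if Odd (b + p) then 1 else 0

/-- A tile at the junction is counted by both shorter strips. -/
lemma stripCount_add (e₁ e₂ p : ℕ) :
    stripCount (e₁ + e₂) p + (if Odd (e₁ + p) then 1 else 0) =
      stripCount e₁ p + stripCount e₂ (p + e₁) := by
  unfold stripCount
  rw [add_assoc, Finset.sum_range_add, Finset.sum_range_succ _ e₁]
  have : ∀ b, e₁ + b + p = b + (p + e₁) := fun b => by omega
  simp only [this]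
  omega

lemma card_xTile (d e s : ℕ) :
    Fintype.card (XTile d e s) = ∑ a ∈ Finset.Ico 1 d, stripCount e (a + s) := by
  rw [Fintype.card_subtype, Finset.card_filter, Fintype.sum_prod_type,
    Fin.sum_univ_eq_sum_range (fun a => ∑ b : Fin (e + 1),
      if 0 < a ∧ a < d ∧ Odd (a + b.val + s) then 1 else 0)]
  have h : ∀ a, (∑ b : Fin (e + 1), if 0 < a ∧ a < d ∧ Odd (a + b.val + s) then 1 else 0) =
      if 0 < a ∧ a < d then stripCount e (a + s) else 0 := by
    intro a
    split_ifs with h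
    · rw [Fin.sum_univ_eq_sum_range (fun b => if 0 < a ∧ a < d ∧ Odd (a + b + s) then 1 else 0)]
      refine Finset.sum_congr rfl fun b _ => if_congr ?_ rfl rfl
      rw [show a + b + s = b + (a + s) by omega]
      tauto
    · exact Finset.sum_eq_zero fun b _ => if_neg fun h' => h ⟨h'.1, h'.2.1⟩
  simp only [h]
  rw [← Finset.sum_filter]
  refine Finset.sum_congr ?_ fun _ _ => rfl
  ext a
  simp only [Finset.mem_filter, Finset.mem_range, Finset.mem_Ico]
  omega

lemma length_zSplitTiles (d e₁ s : ℕ) : (zSplitTiles d e₁ s).length =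
    ∑ a ∈ Finset.Ico 1 d, if Odd (e₁ + (a + s)) then 1 else 0 := by
  rw [zSplitTiles, length_filter_finRange,
    Fin.sum_univ_eq_sum_range (fun a => if 0 < a ∧ a < d ∧ Odd (a + e₁ + s) then 1 else 0)]
  rw [← Finset.sum_filter, ← Finset.sum_filter]
  refine Finset.sum_congr ?_ fun _ _ => rfl
  ext a
  simp only [Finset.mem_filter, Finset.mem_range, Finset.mem_Ico, Nat.odd_iff]
  omega

lemma length_xMergeTiles (d₁ e s : ℕ) :
    (xMergeTiles d₁ e s).length = stripCount e (d₁ + s) := by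
  rw [xMergeTiles, length_filter_finRange,
    Fin.sum_univ_eq_sum_range (fun b => if Odd (d₁ + b + s) then 1 else 0)]
  refine Finset.sum_congr rfl fun b _ => ?_
  rw [show d₁ + b + s = b + (d₁ + s) by omega]

lemma card_xTile_sideBySide (d e₁ e₂ s : ℕ) :
    Fintype.card (XTile d (e₁ + e₂) s) + (zSplitTiles d e₁ s).length =
      Fintype.card (XTile d e₁ s) + Fintype.card (XTile d e₂ (s + e₁)) := by
  simp only [card_xTile, length_zSplitTiles, ← Finset.sum_add_distrib]
  refine Finset.sum_congr rfl fun a _ => ?_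
  rw [stripCount_add, add_assoc]

/-- Neither patch has X tiles on the seam, so all X tiles of the seam are new. -/
lemma card_xTile_stacked {d₁ d₂ : ℕ} (h₁ : 0 < d₁) (h₂ : 0 < d₂) (e s : ℕ) :
    Fintype.card (XTile (d₁ + d₂) e s) = Fintype.card (XTile d₁ e s) +
      Fintype.card (XTile d₂ e (s + d₁)) + (xMergeTiles d₁ e s).length := by
  simp only [card_xTile, length_xMergeTiles]
  rw [← Finset.sum_Ico_consecutive _ (show 1 ≤ d₁ from h₁) (show d₁ ≤ d₁ + d₂ by omega),
    Finset.sum_eq_sum_Ico_succ_bot (show d₁ < d₁ + d₂ by omega), add_assoc]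
  congr 1
  rw [add_comm, add_comm d₁ 1, add_comm d₁ d₂, ← Finset.sum_Ico_add']
  congr 1
  refine Finset.sum_congr rfl fun a _ => ?_
  rw [add_assoc, add_comm d₁ s]

lemma xSplitTiles_eq_zSplitTiles (d₁ e s : ℕ) : xSplitTiles d₁ e s = zSplitTiles e d₁ (s + 1) := by
  refine List.filter_congr fun b _ => ?_
  simp only [Nat.even_iff, Nat.odd_iff, decide_eq_decide]
  omega

lemma zMergeTiles_eq_xMergeTiles (d e₁ s : ℕ) : zMergeTiles d e₁ s = xMergeTiles e₁ d (s + 1) := by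
  refine List.filter_congr fun b _ => ?_
  simp only [Nat.even_iff, Nat.odd_iff, decide_eq_decide]
  omega

/-- Lengthening the seam from e to e + 1 adds position e + 1 to the X tiles exactly when it adds
position e to the interior Z tiles, as the colours alternate. -/
lemma length_xMergeTiles_eq_length_xSplitTiles_add_one (d₁ : ℕ) {e : ℕ} (he : 0 < e) (s : ℕ) :
    (xMergeTiles d₁ e s).length = (xSplitTiles d₁ e s).length + 1 := by
  rw [length_xMergeTiles, xSplitTiles_eq_zSplitTiles, length_zSplitTiles]
  induction e, he using Nat.le_induction with
  | base =>
    rw [stripCount]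
    simp only [Nat.odd_iff, Finset.sum_range_succ, Finset.sum_range_zero, Nat.succ_eq_add_one,
      zero_add, Finset.Ico_self, Finset.sum_empty]
    split_ifs <;> omega
  | succ e he ih =>
    rw [Finset.sum_Ico_succ_top he, stripCount, Finset.sum_range_succ, ← stripCount, ih,
      add_right_comm]
    congr 2
    exact if_congr (by simp only [Nat.odd_iff]; omega) rfl rfl

lemma card_zTile (d e s : ℕ) :
    Fintype.card (ZTile d e s) = Fintype.card (XTile e d (s + 1)) :=
  Fintype.card_congr (zTileEquiv d e s)

/-- A new row adds the m X tiles on the seam. It adds e - 1 Z tiles of its own, less the m - 1 seam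
blobs that merge in pairs. The total grows by e. -/
lemma card_xTile_add_card_zTile {d e : ℕ} (hd : 0 < d) (he : 0 < e) (s : ℕ) :
    Fintype.card (XTile d e s) + Fintype.card (ZTile d e s) + 1 = d * e := by
  have hone : ∀ e, 0 < e → ∀ s, Fintype.card (XTile e 1 s) + 1 = e := by
    intro e he s
    have : ∀ p, stripCount 1 p = 1 := by
      intro p
      simp only [stripCount, Nat.odd_iff, Finset.sum_range_succ, Finset.sum_range_zero]
      split_ifs <;> omega
    simp only [card_xTile, this]
    simp
    omega
  rw [card_zTile]
  induction d, hd using Nat.le_induction generalizing s with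
  | base =>
    have : Fintype.card (XTile 1 e s) = 0 := by simp [card_xTile]
    have := hone e he (s + 1)
    simp only [Nat.succ_eq_add_one, zero_add, one_mul]
    omega
  | succ d hd ih =>
    have h1 := card_xTile_stacked hd one_pos e s
    have h2 := card_xTile_sideBySide e d 1 (s + 1)
    have h3 := length_xMergeTiles_eq_length_xSplitTiles_add_one d he s
    have h4 : Fintype.card (XTile 1 e (s + d)) = 0 := by simp [card_xTile]
    have h5 := hone e he (s + 1 + d)
    rw [xSplitTiles_eq_zSplitTiles] at h3
    have := ih s
    rw [add_mul, one_mul]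
    omega

/-! ### The patch as a CSS code -/

lemma isCSSCode {d e : ℕ} (hd : 0 < d) (he : 0 < e) (s : ℕ) :
    IsCSSCode (xStab d e s) (zStab d e s) (logicalX d e) (logicalZ d e) where
  indepX := linearIndependent_xStab d he s
  indepZ := linearIndependent_zStab hd e s
  orth := zStab_dotProduct_xStab
  orthX := zStab_dotProduct_logicalX
  orthZ := logicalZ_dotProduct_xStab
  pairing := logicalZ_dotProduct_logicalX hd he
  card := by rw [card_xTile_add_card_zTile hd he, Fintype.card_prod, Fintype.card_fin,
    Fintype.card_fin]

lemma exists_dotProduct_xStab_eq {d e : ℕ} (hd : 0 < d) (he : 0 < e) (s : ℕ)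
    (f : XTile d e s → ZMod 2) :
    ∃ v : Qubit d e → ZMod 2, (∀ t, v ⬝ᵥ xStab d e s t = f t) ∧ v ⬝ᵥ logicalX d e = 0 := by
  have h := isCSSCode hd he s
  obtain ⟨v, hv⟩ := exists_dotProduct_eq
    (linearIndependent_option_of_dotProduct h.indepX h.orthZ h.pairing) fun t => t.elim 0 f
  exact ⟨v, fun t => hv (some t), hv none⟩

/-! ### Entries of the logical operations -/

lemma fin_two_eq_const_iff (z : Fin 2 → ZMod 2) (a : ZMod 2) :
    z = (fun _ => a) ↔ z 0 = a ∧ z 1 = a := by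
  rw [funext_iff, Fin.forall_fin_two]

lemma fin_one_eq_iff (z w : Fin 1 → ZMod 2) : z = w ↔ z 0 = w 0 := by
  rw [funext_iff, Fin.forall_fin_one]

lemma zSplit_apply (y : Fin 2 → ZMod 2) (x : Fin 1 → ZMod 2) :
    zSplit y x = if y = fun _ => x 0 then 1 else 0 := by
  rw [zSplit, zSpider, star_ketZ, star_ketZ]
  simp only [fin_two_eq_const_iff, Matrix.add_apply, Matrix.smul_apply, Matrix.vecMulVec_apply,
    ketZ, Fin.prod_univ_two, Fin.prod_univ_one]
  rcases eq_zero_or_eq_one (y 0) with h0 | h0 <;> rcases eq_zero_or_eq_one (y 1) with h1 | h1 <;>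
    rcases eq_zero_or_eq_one (x 0) with h2 | h2 <;> simp [h0, h1, h2]

lemma exp_val_mul_pi (k : ZMod 2) :
    Complex.exp (((k.val * Real.pi : ℝ) : ℂ) * Complex.I) = sgn k := by
  rcases eq_zero_or_eq_one k with rfl | rfl
  · simp
  · simp [ZMod.val_one]

lemma zSpider_one_one_apply (k : ZMod 2) (y x : Fin 1 → ZMod 2) :
    zSpider 1 1 (k.val * Real.pi) y x = if y = x then sgn (k * x 0) else 0 := by
  rw [zSpider, star_ketZ, star_ketZ, exp_val_mul_pi]
  simp only [fin_one_eq_iff, Matrix.add_apply, Matrix.smul_apply, Matrix.vecMulVec_apply,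
    ketZ, Fin.prod_univ_one]
  rcases eq_zero_or_eq_one (y 0) with h0 | h0 <;> rcases eq_zero_or_eq_one (x 0) with h1 | h1 <;>
    simp [h0, h1]

lemma xSpider_two_one_apply (y : Fin 1 → ZMod 2) (x : Fin 2 → ZMod 2) :
    xSpider 2 1 0 y x = if y = (fun _ => x 0 + x 1) then (1 / (√2 : ℝ) : ℂ) else 0 := by
  rw [xSpider, star_ketX, star_ketX]
  simp only [fin_one_eq_iff, Matrix.add_apply, Matrix.smul_apply, Matrix.vecMulVec_apply,
    ketX, Fin.prod_univ_one, Fin.prod_univ_two]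
  have h := inv_sqrt_two_sq
  rw [div_pow, one_pow] at h
  have h11 : (1 : ZMod 2) + 1 = 0 := rfl
  rcases eq_zero_or_eq_one (y 0) with h0 | h0 <;> rcases eq_zero_or_eq_one (x 0) with h1 | h1 <;>
    rcases eq_zero_or_eq_one (x 1) with h2 | h2 <;> simp [h0, h1, h2, h11] <;>
    -- When the parities match, the two terms add up to 2 (1/√2)³ = 1/√2.
    first | ring1 | linear_combination (2 * (1 / (√2 : ℝ) : ℂ)) * h

lemma xMerge_apply (k : ZMod 2) (y : Fin 1 → ZMod 2) (x : Fin 2 → ZMod 2) :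
    xMerge k y x = if y = (fun _ => x 0 + x 1) then
      (1 / (√2 : ℝ) : ℂ) * sgn (k * x 0) else 0 := by
  have h : tensor twoQubits twoQubits (zSpider 1 1 (k.val * Real.pi)) 1 =
      Matrix.diagonal fun x : Fin 2 → ZMod 2 => sgn (k * x 0) := by
    ext z x
    have h0 : twoQubits (Sum.inl 0) = 0 := rfl
    have h1 : twoQubits (Sum.inr 0) = 1 := rfl
    simp only [tensor, zSpider_one_one_apply, Matrix.one_apply, Matrix.diagonal_apply,
      fin_one_eq_iff, h0, h1, ite_zero_mul_ite_zero, mul_one]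
    refine if_ctx_congr ?_ (fun h => ?_) fun _ => rfl
    · rw [funext_iff, Fin.forall_fin_two]
    · rw [h]
  rw [xMerge, h, Matrix.mul_diagonal, xSpider_two_one_apply, ite_mul, zero_mul]

lemma xMerge_eq_mul_pauliZ (k : ZMod 2) :
    xMerge k = xMerge 0 * pauliZ (fun i : Fin 2 => if i = 0 then k else 0) := by
  ext y x
  rw [mul_pauliZ_apply, xMerge_apply, xMerge_apply]
  simp [dotProduct]

section

variable {ι τ : Type} [Fintype ι] [DecidableEq ι] [Fintype τ] [DecidableEq τ]

lemma cssMap_mul_zSplit (g : τ → ι → ZMod 2) (o : (Fin 2 → ZMod 2) → ι → ZMod 2) :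
    cssMap g o * zSplit = cssMap g fun x => o fun _ => x 0 := by
  ext y x
  rw [Matrix.mul_apply]
  simp only [zSplit_apply, mul_ite, mul_one, mul_zero, Finset.sum_ite_eq', Finset.mem_univ, if_true]
  rfl

lemma cssDiagram_mul_xMerge_zero (g : τ → ι → ZMod 2) (ℓ : ι → ZMod 2) :
    cssDiagram g ℓ * xMerge 0 =
      (1 / (√2 : ℝ) : ℂ) • cssMap g fun x : Fin 2 → ZMod 2 => (x 0 + x 1) • ℓ := by
  ext y x
  rw [Matrix.mul_apply]
  simp only [xMerge_apply, mul_ite, mul_zero, Finset.sum_ite_eq', Finset.mem_univ, if_true,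
    zero_mul, sgn_zero, mul_one]
  rw [Matrix.smul_apply, smul_eq_mul, mul_comm]
  rfl

end

/-! ### Tiles of a pair of patches -/

section Pairs

variable {d d₁ d₂ e e₁ e₂ a b : ℕ}

lemma tile_sideBySide_left (h : b < e₁) :
    tile d (e₁ + e₂) a b = glue (sideBySide d e₁ e₂) (tile d e₁ a b) 0 := by
  rw [eq_iff_restrict (sideBySide d e₁ e₂)]
  refine ⟨fun q => ?_, fun q => ?_⟩
  · rw [glue_inl]; rfl
  · rw [glue_inr]
    refine if_neg ?_
    change ¬ ((_ ∧ (e₁ + q.2.val = b ∨ e₁ + q.2.val + 1 = b)))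
    omega

lemma tile_sideBySide_right (h : 0 < b) :
    tile d (e₁ + e₂) a (e₁ + b) = glue (sideBySide d e₁ e₂) 0 (tile d e₂ a b) := by
  rw [eq_iff_restrict (sideBySide d e₁ e₂)]
  refine ⟨fun q => ?_, fun q => ?_⟩
  · rw [glue_inl]
    refine if_neg ?_
    change ¬ ((_ ∧ (q.2.val = e₁ + b ∨ q.2.val + 1 = e₁ + b)))
    omega
  · rw [glue_inr]
    refine if_congr ?_ rfl rfl
    change (_ ∧ (e₁ + q.2.val = e₁ + b ∨ e₁ + q.2.val + 1 = e₁ + b)) ↔ _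
    exact and_congr Iff.rfl (by omega)

lemma tile_sideBySide_middle :
    tile d (e₁ + e₂) a e₁ = glue (sideBySide d e₁ e₂) (tile d e₁ a e₁) (tile d e₂ a 0) := by
  rw [eq_iff_restrict (sideBySide d e₁ e₂)]
  refine ⟨fun q => ?_, fun q => ?_⟩
  · rw [glue_inl]; rfl
  · rw [glue_inr]
    refine if_congr ?_ rfl rfl
    change (_ ∧ (e₁ + q.2.val = e₁ ∨ e₁ + q.2.val + 1 = e₁)) ↔ _
    exact and_congr Iff.rfl (by omega)

lemma blob_sideBySide :
    (fun q => if q.2.val < e₁ then tile d (e₁ + e₂) a e₁ q else 0) =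
      glue (sideBySide d e₁ e₂) (tile d e₁ a e₁) 0 := by
  rw [eq_iff_restrict (sideBySide d e₁ e₂)]
  refine ⟨fun q => ?_, fun q => ?_⟩
  · rw [glue_inl]
    exact if_pos q.2.2
  · rw [glue_inr]
    refine if_neg ?_
    change ¬ (e₁ + q.2.val < e₁)
    omega

lemma logicalX_sideBySide :
    logicalX d (e₁ + e₂) = glue (sideBySide d e₁ e₂) (logicalX d e₁) (logicalX d e₂) := by
  rw [eq_iff_restrict (sideBySide d e₁ e₂)]
  exact ⟨fun q => by rw [glue_inl]; rfl, fun q => by rw [glue_inr]; rfl⟩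

lemma tile_stacked_upper (h : a < d₁) :
    tile (d₁ + d₂) e a b = glue (stacked d₁ d₂ e) (tile d₁ e a b) 0 := by
  rw [eq_iff_restrict (stacked d₁ d₂ e)]
  refine ⟨fun q => ?_, fun q => ?_⟩
  · rw [glue_inl]; rfl
  · rw [glue_inr]
    refine if_neg ?_
    change ¬ (((d₁ + q.1.val = a ∨ d₁ + q.1.val + 1 = a) ∧ _))
    omega

lemma tile_stacked_lower (h : 0 < a) :
    tile (d₁ + d₂) e (d₁ + a) b = glue (stacked d₁ d₂ e) 0 (tile d₂ e a b) := by
  rw [eq_iff_restrict (stacked d₁ d₂ e)]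
  refine ⟨fun q => ?_, fun q => ?_⟩
  · rw [glue_inl]
    refine if_neg ?_
    change ¬ (((q.1.val = d₁ + a ∨ q.1.val + 1 = d₁ + a) ∧ _))
    omega
  · rw [glue_inr]
    refine if_congr ?_ rfl rfl
    change ((d₁ + q.1.val = d₁ + a ∨ d₁ + q.1.val + 1 = d₁ + a) ∧ _) ↔ _
    exact and_congr (by omega) Iff.rfl

lemma rowVec_stacked_upper (h : 0 < d₁) :
    rowVec (d₁ + d₂) e (d₁ - 1) = glue (stacked d₁ d₂ e) (logicalX d₁ e) 0 := by
  rw [eq_iff_restrict (stacked d₁ d₂ e)]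
  refine ⟨fun q => ?_, fun q => ?_⟩
  · rw [glue_inl]
    refine if_congr ?_ rfl rfl
    change q.1.val = d₁ - 1 ↔ _
    omega
  · rw [glue_inr]
    refine if_neg ?_
    change ¬ (d₁ + q.1.val = d₁ - 1)
    omega

lemma logicalX_stacked (h : 0 < d₂) :
    logicalX (d₁ + d₂) e = glue (stacked d₁ d₂ e) 0 (logicalX d₂ e) := by
  rw [eq_iff_restrict (stacked d₁ d₂ e)]
  refine ⟨fun q => ?_, fun q => ?_⟩
  · rw [glue_inl]
    refine if_neg ?_
    change ¬ (q.1.val + 1 = d₁ + d₂)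
    omega
  · rw [glue_inr]
    refine if_congr ?_ rfl rfl
    change d₁ + q.1.val + 1 = d₁ + d₂ ↔ _
    omega

end Pairs

lemma dotProduct_glue {ι₁ ι₂ ι : Type} [Fintype ι₁] [Fintype ι₂] [Fintype ι] [DecidableEq ι₁]
    [DecidableEq ι₂] [DecidableEq ι] (φ : ι₁ ⊕ ι₂ ≃ ι) (v v' : ι₁ → ZMod 2) (w w' : ι₂ → ZMod 2) :
    glue φ v w ⬝ᵥ glue φ v' w' = v ⬝ᵥ v' + w ⬝ᵥ w' := by
  rw [dotProduct_eq_restrict φ]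
  simp only [glue_inl, glue_inr]

/-! ### Z-split -/

lemma exists_physZSplit_mul_encoder {d e₁ e₂ : ℕ} (hd : 0 < d) (h₁ : 0 < e₁) (h₂ : 0 < e₂) (s : ℕ)
    (j : Fin (d + 1) → ZMod 2) : ∃ v : Qubit d (e₁ + e₂) → ZMod 2,
      physZSplit d e₁ e₂ s j * encoder d (e₁ + e₂) s =
      (1 / (√2 : ℝ) : ℂ) ^ (zSplitTiles d e₁ s).length •
        (pauliZ v * (sideBySideEncoder d e₁ e₂ s * zSplit)) := by
  -- Both halves of a seam tile are given pairing j, so the glued string detects the measured left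
  -- blob but not the whole tile, and Z^v fixes the wide encoder.
  obtain ⟨v₁, hv₁, hl₁⟩ := exists_dotProduct_xStab_eq hd h₁ s
    fun t => if t.1.2.val = e₁ then j t.1.1 else 0
  obtain ⟨v₂, hv₂, hl₂⟩ := exists_dotProduct_xStab_eq hd h₂ (s + e₁)
    fun t => if t.1.2.val = 0 then j t.1.1 else 0
  have hmem : ∀ a ∈ zSplitTiles d e₁ s, 0 < a.val ∧ a.val < d ∧ Odd (a.val + e₁ + s) := by
    intro a ha
    simpa [zSplitTiles] using ha
  have hL : ∀ (a : Fin (d + 1)) (h : 0 < a.val ∧ a.val < d ∧ Odd (a.val + e₁ + s)),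
      v₁ ⬝ᵥ tile d e₁ a e₁ = j a := by
    intro a h
    exact (hv₁ ⟨(a, Fin.last e₁), h⟩).trans (if_pos rfl)
  have hR : ∀ (a : Fin (d + 1)) (h : 0 < a.val ∧ a.val < d ∧ Odd (a.val + e₁ + s)),
      v₂ ⬝ᵥ tile d e₂ a 0 = j a := by
    intro a h
    refine (hv₂ ⟨(a, 0), h.1, h.2.1, ?_⟩).trans (if_pos rfl)
    rw [show (a.val + (0 : Fin (e₂ + 1)).val + (s + e₁)) = a.val + e₁ + s by simp; omega]
    exact h.2.2
  set ψ := sideBySide d e₁ e₂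
  refine ⟨glue ψ v₁ v₂, ?_⟩
  rw [physZSplit, list_prod_proj_pauliX_eq_conj (v := glue ψ v₁ v₂), Matrix.mul_assoc,
    Matrix.mul_assoc]
  swap
  · intro a ha
    rw [blob_sideBySide, dotProduct_glue, dotProduct_zero, add_zero, hL a (hmem a ha)]
  have hfix : pauliZ (glue ψ v₁ v₂) * encoder d (e₁ + e₂) s = encoder d (e₁ + e₂) s := by
    ext y x
    rw [encoder, cssDiagram_eq_cssMap, pauliZ_mul_cssMap]
    · rw [dotProduct_smul, logicalX_sideBySide, dotProduct_glue, hl₁, hl₂]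
      simp
    · rintro ⟨⟨a, ⟨b, hb⟩⟩, h0, h1, hodd⟩
      simp only [xStab] at h0 h1 hodd ⊢
      rcases lt_trichotomy b e₁ with h | rfl | h
      · rw [tile_sideBySide_left h, dotProduct_glue, dotProduct_zero, add_zero]
        exact (hv₁ ⟨(a, ⟨b, by omega⟩), h0, h1, hodd⟩).trans (if_neg h.ne)
      · rw [tile_sideBySide_middle, dotProduct_glue, hL a ⟨h0, h1, hodd⟩, hR a ⟨h0, h1, hodd⟩]
        exact CharTwo.add_self_eq_zero _
      · obtain ⟨b, rfl⟩ := Nat.exists_eq_add_of_lt h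
        rw [add_assoc, tile_sideBySide_right (Nat.succ_pos b), dotProduct_glue, dotProduct_zero,
          zero_add]
        refine (hv₂ ⟨(a, ⟨b + 1, by omega⟩), h0, h1, ?_⟩).trans (if_neg (Nat.succ_ne_zero b))
        rw [show a.val + (b + 1) + (s + e₁) = a.val + (e₁ + b + 1) + s by omega]
        exact hodd
  rw [hfix, encoder, cssDiagram_eq_cssMap]
  obtain ⟨τ', _, _, g', hcard, hg, hu, h⟩ := exists_list_prod_proj_mul_cssMap (zSplitTiles d e₁ s)
    (fun a q => if q.2.val < e₁ then tile d (e₁ + e₂) a e₁ q else 0) (xStab d (e₁ + e₂) s)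
    fun x : Fin 1 → ZMod 2 => x 0 • logicalX d (e₁ + e₂)
  rw [h, Matrix.mul_smul, sideBySideEncoder, encoder, encoder, tensor_cssDiagram, cssMap_mul_zSplit]
  congr 2
  refine cssMap_congr (linearIndependent_glue _ (linearIndependent_xStab d h₁ s)
    (linearIndependent_xStab d h₂ (s + e₁))) ?_ ?_ ?_
  · rw [hcard, Fintype.card_sum, card_xTile_sideBySide]
  · have hmid : ∀ (a : Fin (d + 1)) (h : 0 < a.val ∧ a.val < d ∧ Odd (a.val + e₁ + s)),
        glue ψ (tile d e₁ a e₁) 0 ∈ Submodule.span (ZMod 2) (Set.range g') := by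
      intro a h
      rw [← blob_sideBySide]
      exact Submodule.subset_span (hu a (by simpa [zSplitTiles] using h))
    rintro (⟨⟨a, ⟨b, hb⟩⟩, h0, h1, hodd⟩ | ⟨⟨a, ⟨b, hb⟩⟩, h0, h1, hodd⟩)
    · simp only [Sum.elim_inl, xStab] at h0 h1 hodd ⊢
      rcases Nat.lt_succ_iff_lt_or_eq.1 hb with h | rfl
      · rw [← tile_sideBySide_left h]
        exact Submodule.subset_span (hg ⟨(a, ⟨b, by omega⟩), h0, h1, hodd⟩)
      · exact hmid a ⟨h0, h1, hodd⟩
    · simp only [Sum.elim_inr, xStab] at h0 h1 hodd ⊢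
      have hodd' : Odd (a.val + (e₁ + b) + s) := by
        rwa [show a.val + (e₁ + b) + s = a.val + b + (s + e₁) by omega]
      have hwide : tile d (e₁ + e₂) a (e₁ + b) ∈ Submodule.span (ZMod 2) (Set.range g') :=
        Submodule.subset_span (hg ⟨(a, ⟨e₁ + b, by omega⟩), h0, h1, hodd'⟩)
      rcases Nat.eq_zero_or_pos b with rfl | h
      -- A left-boundary blob of the right patch is the wide seam tile minus the measured blob.
      · have := Submodule.sub_mem _ hwide (hmid a ⟨h0, h1, hodd'⟩)
        rw [add_zero, tile_sideBySide_middle] at this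
        convert this using 1
        rw [eq_iff_restrict ψ]
        simp [ψ]
      · rwa [← tile_sideBySide_right h]
  · intro x
    have : (x 0 • glue ψ (logicalX d e₁) 0 + x 0 • glue ψ 0 (logicalX d e₂)) =
        x 0 • logicalX d (e₁ + e₂) := by
      rw [logicalX_sideBySide, ← smul_add]
      congr 1
      rw [eq_iff_restrict ψ]
      simp [ψ]
    rw [this, sub_self]
    exact Submodule.zero_mem _

/-! ### X-merge -/

lemma exists_physXMerge_mul_stackedEncoder {d₁ d₂ e : ℕ} (h₁ : 0 < d₁) (h₂ : 0 < d₂) (he : 0 < e)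
    (s : ℕ) (j : Fin (e + 1) → ZMod 2) : ∃ v : Qubit (d₁ + d₂) e → ZMod 2,
      physXMerge d₁ d₂ e s j * stackedEncoder d₁ d₂ e s =
      (1 / (√2 : ℝ) : ℂ) ^ ((xMergeTiles d₁ e s).length - 1) •
        (pauliZ v * (encoder (d₁ + d₂) e s * xMerge ((xMergeTiles d₁ e s).map j).sum)) := by
  -- The string v sees only the seam tiles; its pairing with the bottom row is normalised to 0.
  obtain ⟨v, hv, hl⟩ := exists_dotProduct_xStab_eq (d := d₁ + d₂) (by omega) he s
    fun t => if t.1.1.val = d₁ then j t.1.2 else 0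
  set k := ((xMergeTiles d₁ e s).map j).sum with hk
  have hmem : ∀ b, b ∈ xMergeTiles d₁ e s ↔ Odd (d₁ + b.val + s) := fun b => by simp [xMergeTiles]
  have hmid : ∀ b : Fin (e + 1), Odd (d₁ + b.val + s) → v ⬝ᵥ tile (d₁ + d₂) e d₁ b = j b := by
    intro b hb
    exact (hv ⟨(⟨d₁, by omega⟩, b), h₁, by simpa using h₂, hb⟩).trans (if_pos rfl)
  have hstrip : ∀ a, 0 < a → v ⬝ᵥ rowVec (d₁ + d₂) e (a - 1) + v ⬝ᵥ rowVec (d₁ + d₂) e a =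
      ∑ b : Fin (e + 1), if Odd (a + b.val + s) then v ⬝ᵥ tile (d₁ + d₂) e a b else 0 := by
    intro a ha
    rw [← dotProduct_add, ← sum_tile_eq_rowVec_add _ _ s ha, dotProduct_sum]
    exact Finset.sum_congr rfl fun b _ => by split_ifs <;> simp
  -- Strips below the seam pair to 0 with v, so consecutive rows there have equal pairing; crossing
  -- the seam then adds the sum of the outcomes.
  have hlow : ∀ r, d₁ ≤ r → r < d₁ + d₂ →
      v ⬝ᵥ rowVec (d₁ + d₂) e r = v ⬝ᵥ rowVec (d₁ + d₂) e d₁ := by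
    intro r hr
    induction r, hr using Nat.le_induction with
    | base => simp
    | succ r hr ih =>
      intro hlt
      rw [← ih (by omega), eq_comm, ← CharTwo.add_eq_zero]
      have := hstrip (r + 1) (Nat.succ_pos r)
      rw [Nat.add_sub_cancel] at this
      rw [this]
      refine Finset.sum_eq_zero fun b _ => ?_
      split_ifs with hodd
      · exact (hv ⟨(⟨r + 1, by omega⟩, b), Nat.succ_pos r, hlt, hodd⟩).trans
          (if_neg (show r + 1 ≠ d₁ by omega))
      · rfl
  have hup : v ⬝ᵥ rowVec (d₁ + d₂) e (d₁ - 1) = k := by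
    have h := hstrip d₁ h₁
    rw [← hlow (d₁ + d₂ - 1) (by omega) (by omega), ← logicalX_eq_rowVec (by omega), hl,
      add_zero] at h
    rw [h, hk, xMergeTiles, sum_map_filter_finRange]
    exact Finset.sum_congr rfl fun b _ => if_ctx_congr Iff.rfl (fun hb => hmid b hb) fun _ => rfl
  -- The truncated subtraction is harmless since at least one tile is measured.
  have hpos : (xMergeTiles d₁ e s).length - 1 + 1 = (xMergeTiles d₁ e s).length := by
    rw [length_xMergeTiles_eq_length_xSplitTiles_add_one _ he, Nat.add_sub_cancel]
  refine ⟨v, ?_⟩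
  set ψ := stacked d₁ d₂ e
  have hphase : pauliZ v * stackedEncoder d₁ d₂ e s =
      stackedEncoder d₁ d₂ e s * pauliZ (fun i : Fin 2 => if i = 0 then k else 0) := by
    ext y x
    rw [mul_pauliZ_apply, stackedEncoder, encoder, encoder, tensor_cssDiagram, pauliZ_mul_cssMap]
    · rw [← rowVec_stacked_upper h₁, ← logicalX_stacked h₂, dotProduct_add, dotProduct_smul,
        dotProduct_smul, hl, hup]
      simp [dotProduct, mul_comm]
    · rintro (⟨⟨⟨a, ha⟩, b⟩, h0, h1, hodd⟩ | ⟨⟨⟨a, ha⟩, b⟩, h0, h1, hodd⟩)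
      · simp only [Sum.elim_inl, xStab] at h0 h1 hodd ⊢
        rw [← tile_stacked_upper h1]
        exact (hv ⟨(⟨a, by omega⟩, b), h0, by simp only; omega, hodd⟩).trans (if_neg h1.ne)
      · simp only [Sum.elim_inr, xStab] at h0 h1 hodd ⊢
        rw [← tile_stacked_lower h0]
        refine (hv ⟨(⟨d₁ + a, by omega⟩, b), by simp only; omega, by simp only; omega, ?_⟩).trans
          (if_neg (show d₁ + a ≠ d₁ by omega))
        simp only
        rwa [show d₁ + a + b.val + s = a + b.val + (s + d₁) by omega]
  -- Both sides acquire Z^v on the output and Z^k on the first input. Once these are stripped, the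
  -- claim for outcomes 0 remains, with one factor 1/√2 coming from the X spider.
  rw [physXMerge, list_prod_proj_pauliX_eq_conj (v := v) (hv := fun b hb => hmid b ((hmem b).1 hb)),
    Matrix.mul_assoc, Matrix.mul_assoc, hphase, xMerge_eq_mul_pauliZ,
    ← Matrix.mul_assoc (encoder _ _ _), ← Matrix.mul_assoc _ (stackedEncoder d₁ d₂ e s), ← Matrix.mul_smul, ← Matrix.smul_mul]
  congr 2
  rw [stackedEncoder, encoder, encoder, tensor_cssDiagram, encoder, cssDiagram_mul_xMerge_zero,
    smul_smul, ← pow_succ, hpos]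
  obtain ⟨τ', _, _, g', hcard, hg, hu, h⟩ := exists_list_prod_proj_mul_cssMap (xMergeTiles d₁ e s)
    (fun b : Fin (e + 1) => tile (d₁ + d₂) e d₁ b)
    (Sum.elim (fun t => glue ψ (xStab d₁ e s t) 0) fun t => glue ψ 0 (xStab d₂ e (s + d₁) t))
    fun x : Fin 2 → ZMod 2 => x 0 • glue ψ (logicalX d₁ e) 0 + x 1 • glue ψ 0 (logicalX d₂ e)
  rw [h]
  congr 1
  refine cssMap_congr (linearIndependent_xStab _ he s) ?_ ?_ ?_
  · rw [hcard, Fintype.card_sum, card_xTile_stacked h₁ h₂]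
  · rintro ⟨⟨⟨a, ha⟩, b⟩, h0, h1, hodd⟩
    simp only [xStab] at h0 h1 hodd ⊢
    refine Submodule.subset_span ?_
    rcases lt_trichotomy a d₁ with h | rfl | h
    · rw [tile_stacked_upper h]
      exact hg (.inl ⟨(⟨a, by omega⟩, b), h0, h, hodd⟩)
    · exact hu b ((hmem b).2 hodd)
    · obtain ⟨a, rfl⟩ := Nat.exists_eq_add_of_lt h
      rw [add_assoc, tile_stacked_lower (Nat.succ_pos a)]
      refine hg (.inr ⟨(⟨a + 1, by omega⟩, b), Nat.succ_pos a, by simp only; omega, ?_⟩)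
      simp only
      rwa [show a + 1 + b.val + (s + d₁) = d₁ + a + 1 + b.val + s by omega]
  · intro x
    rw [← rowVec_stacked_upper h₁, ← logicalX_stacked h₂, add_smul, add_sub_add_right_eq_sub,
      ← smul_sub, logicalX_eq_rowVec (by omega)]
    exact Submodule.smul_mem _ _ (rowVec_sub_mem_span (by omega) (by omega))

/-! ### Transposition of patches -/

/-- The bit string on the transposed patch. -/
def transposeEquiv (d e : ℕ) : (Qubit d e → ZMod 2) ≃ (Qubit e d → ZMod 2) where
  toFun y q := y q.swap
  invFun y q := y q.swap
  left_inv _ := rfl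
  right_inv _ := rfl

lemma proj_pauliX_transpose {d e : ℕ} (u : Qubit e d → ZMod 2) (k : ZMod 2) :
    (proj (pauliX u) k).submatrix (transposeEquiv d e) (transposeEquiv d e) =
      proj (pauliX ((transposeEquiv d e).symm u)) k := by
  have h : (pauliX u).submatrix (transposeEquiv d e) (transposeEquiv d e) =
      pauliX ((transposeEquiv d e).symm u) := by
    ext y x
    have hy : transposeEquiv d e y = transposeEquiv d e x + u ↔
        y = x + (transposeEquiv d e).symm u := by
      rw [← (transposeEquiv d e).symm.injective.eq_iff, Equiv.symm_apply_apply]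
      rfl
    simp [pauliX, pauli, hy]
  rw [← h]
  ext y x
  simp [proj, Matrix.one_apply, mul_add]

lemma pauliZ_transpose {d e : ℕ} (v : Qubit e d → ZMod 2) :
    (pauliZ v).submatrix (transposeEquiv d e) (transposeEquiv d e) =
      pauliZ ((transposeEquiv d e).symm v) := by
  ext y x
  have hs : ∑ i, v i * transposeEquiv d e x i = ∑ i, (transposeEquiv d e).symm v i * x i :=
    (Equiv.prodComm (Fin d) (Fin e)).sum_comp (fun i => v i * transposeEquiv d e x i) |>.symm
  simp [pauliZ, pauli, hs]

lemma transpose_mul_eq {d e : ℕ} {α β : Type} [Fintype α] [DecidableEq α] [Fintype β]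
    [DecidableEq β] {c : ℂ} {A : QMap (Qubit e d) (Qubit e d)} {B : QMap α (Qubit e d)}
    {C : QMap β (Qubit e d)} {D : QMap α β} {v : Qubit e d → ZMod 2}
    (h : A * B = c • (pauliZ v * (C * D))) :
    A.submatrix (transposeEquiv d e) (transposeEquiv d e) *
        B.submatrix (transposeEquiv d e) id =
      c • (pauliZ ((transposeEquiv d e).symm v) * (C.submatrix (transposeEquiv d e) id * D)) := by
  have hCD : C.submatrix (transposeEquiv d e) id * D =
      (C * D).submatrix (transposeEquiv d e) id := rfl
  rw [Matrix.submatrix_mul_equiv, h, ← pauliZ_transpose, hCD, Matrix.submatrix_mul_equiv]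
  rfl

lemma list_prod_transpose {d e : ℕ} {β : Type} (L : List β) (A : β → QMap (Qubit e d) (Qubit e d)) :
    (L.map A).prod.submatrix (transposeEquiv d e) (transposeEquiv d e) =
      (L.map fun a => (A a).submatrix (transposeEquiv d e) (transposeEquiv d e)).prod := by
  induction L with
  | nil => simp
  | cons a L ih =>
    rw [List.map_cons, List.map_cons, List.prod_cons, List.prod_cons, ← ih,
      Matrix.submatrix_mul_equiv]

/-- Transposition takes the left column to the top row, which differs from the bottom row used by
`encoder` by X stabilisers. -/
lemma cssDiagram_zStab_eq {d e : ℕ} (hd : 0 < d) (he : 0 < e) (s : ℕ) :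
    cssDiagram (zStab d e s) (logicalZ d e) =
      (encoder e d (s + 1)).submatrix (transposeEquiv d e) id := by
  have hrow : encoder e d (s + 1) =
      cssMap (xStab e d (s + 1)) fun x : Fin 1 → ZMod 2 => x 0 • rowVec e d 0 := by
    rw [encoder, cssDiagram_eq_cssMap]
    refine (cssMap_congr (linearIndependent_xStab e hd _) rfl
      (fun t => Submodule.subset_span ⟨t, rfl⟩) fun x => ?_).symm
    rw [← smul_sub, logicalX_eq_rowVec he]
    exact Submodule.smul_mem _ _ (rowVec_sub_mem_span (Nat.zero_le _) (by omega))
  rw [hrow]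
  ext y x
  simp only [cssDiagram, cssMap, Matrix.submatrix_apply, id]
  rw [card_zTile, ← ((zTileEquiv d e s).arrowCongr (Equiv.refl (ZMod 2))).sum_comp]
  congr 1
  refine Finset.sum_congr rfl fun c _ => if_congr ?_ rfl rfl
  rw [← (transposeEquiv d e).injective.eq_iff]
  congr! 1
  ext q
  have h : ∑ t, (zTileEquiv d e s).arrowCongr (Equiv.refl (ZMod 2)) c t * xStab e d (s + 1) t q =
      ∑ t, c t * zStab d e s t q.swap := by
    rw [← (zTileEquiv d e s).sum_comp]
    refine Finset.sum_congr rfl fun t _ => ?_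
    simp [zStab_apply]
  simp only [Pi.add_apply, Finset.sum_apply, Pi.smul_apply, smul_eq_mul, h]
  simp [transposeEquiv, rowVec, logicalZ]

lemma encoder_eq_zEncoder {d e : ℕ} (hd : 0 < d) (he : 0 < e) (s : ℕ) :
    encoder d e s = zEncoder d e s :=
  (isCSSCode hd he s).cssDiagram_eq_hadamard_conj

lemma encoder_eq_hadamard_conj_transpose {d e : ℕ} (hd : 0 < d) (he : 0 < e) (s : ℕ) :
    encoder d e s = hadamard (Qubit d e) *
      (encoder e d (s + 1)).submatrix (transposeEquiv d e) id * hadamard (Fin 1) := by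
  rw [encoder_eq_zEncoder hd he, zEncoder, cssDiagram_zStab_eq hd he]

lemma stackedEncoder_eq_hadamard_conj_transpose {d₁ d₂ e : ℕ} (h₁ : 0 < d₁) (h₂ : 0 < d₂)
    (he : 0 < e) (s : ℕ) :
    stackedEncoder d₁ d₂ e s = hadamard (Qubit (d₁ + d₂) e) *
      (sideBySideEncoder e d₁ d₂ (s + 1)).submatrix (transposeEquiv (d₁ + d₂) e) id *
        hadamard (Fin 2) := by
  rw [stackedEncoder, encoder_eq_hadamard_conj_transpose h₁ he,
    encoder_eq_hadamard_conj_transpose h₂ he, ← tensor_mul_tensor twoQubits twoQubits,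
    ← tensor_mul_tensor twoQubits (stacked d₁ d₂ e), tensor_hadamard, tensor_hadamard,
    add_right_comm s d₁ 1]
  -- Transposition carries the stacked embedding to the side-by-side one definitionally.
  rfl

lemma sideBySideEncoder_eq_hadamard_conj_transpose {d e₁ e₂ : ℕ} (hd : 0 < d) (h₁ : 0 < e₁)
    (h₂ : 0 < e₂) (s : ℕ) :
    sideBySideEncoder d e₁ e₂ s = hadamard (Qubit d (e₁ + e₂)) *
      (stackedEncoder e₁ e₂ d (s + 1)).submatrix (transposeEquiv d (e₁ + e₂)) id *
        hadamard (Fin 2) := by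
  rw [sideBySideEncoder, encoder_eq_hadamard_conj_transpose hd h₁,
    encoder_eq_hadamard_conj_transpose hd h₂, ← tensor_mul_tensor twoQubits twoQubits,
    ← tensor_mul_tensor twoQubits (sideBySide d e₁ e₂), tensor_hadamard, tensor_hadamard,
    add_right_comm s e₁ 1]
  rfl

lemma physXSplit_eq_hadamard_conj_transpose (d₁ d₂ e s : ℕ) (j : Fin (e + 1) → ZMod 2) :
    physXSplit d₁ d₂ e s j = hadamard (Qubit (d₁ + d₂) e) *
      (physZSplit e d₁ d₂ (s + 1) j).submatrix (transposeEquiv (d₁ + d₂) e)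
        (transposeEquiv (d₁ + d₂) e) * hadamard (Qubit (d₁ + d₂) e) := by
  rw [physXSplit, physZSplit, list_prod_transpose, ← list_prod_hadamard_conj,
    xSplitTiles_eq_zSplitTiles]
  simp only [proj_pauliX_transpose, ← proj_pauliZ_eq_hadamard_conj]
  congr! 6 with b q
  rw [tile_swap]
  rfl

lemma physZMerge_eq_hadamard_conj_transpose (d e₁ e₂ s : ℕ) (j : Fin (d + 1) → ZMod 2) :
    physZMerge d e₁ e₂ s j = hadamard (Qubit d (e₁ + e₂)) *
      (physXMerge e₁ e₂ d (s + 1) j).submatrix (transposeEquiv d (e₁ + e₂))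
        (transposeEquiv d (e₁ + e₂)) * hadamard (Qubit d (e₁ + e₂)) := by
  rw [physZMerge, physXMerge, list_prod_transpose, ← list_prod_hadamard_conj,
    zMergeTiles_eq_xMergeTiles]
  simp only [proj_pauliX_transpose, ← proj_pauliZ_eq_hadamard_conj]
  congr! 6 with b
  ext q
  rw [tile_swap]
  rfl

lemma xSplit_eq_hadamard_conj : xSplit = hadamard (Fin 2) * zSplit * hadamard (Fin 1) :=
  xSpider_eq_hadamard_conj 1 2 0

lemma zMerge_eq_hadamard_conj (k : ZMod 2) :
    zMerge k = hadamard (Fin 1) * xMerge k * hadamard (Fin 2) := by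
  have h : tensor twoQubits twoQubits (xSpider 1 1 (k.val * Real.pi)) 1 = hadamard (Fin 2) *
      tensor twoQubits twoQubits (zSpider 1 1 (k.val * Real.pi)) 1 * hadamard (Fin 2) := by
    rw [← tensor_hadamard twoQubits, tensor_mul_tensor, tensor_mul_tensor,
      ← xSpider_eq_hadamard_conj, Matrix.mul_one, hadamard_mul_self]
  rw [zMerge, xMerge, h, xSpider_eq_hadamard_conj]
  simp only [Matrix.mul_assoc]
  rw [← Matrix.mul_assoc (hadamard (Fin 1)) (hadamard (Fin 1)), hadamard_mul_self, Matrix.one_mul]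

/-- Adjacent Hadamards cancel, and the outer ones turn the correction Z^v into X^v. -/
lemma eqUpToPauli_hadamard_conj {ι α β : Type} [Fintype ι] [DecidableEq ι] [Fintype α]
    [DecidableEq α] [Fintype β] [DecidableEq β] {c : ℂ} {A : QMap ι ι} {B : QMap α ι}
    {C : QMap β ι} {D : QMap α β} {v : ι → ZMod 2} (h : A * B = c • (pauliZ v * (C * D))) :
    EqUpToPauli c (hadamard ι * A * hadamard ι * (hadamard ι * B * hadamard α))
      (hadamard ι * C * hadamard β * (hadamard β * D * hadamard α)) := by
  refine ⟨v, 0, ?_⟩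
  rw [show pauli v 0 = pauliX v from rfl]
  have cancel : ∀ {κ γ : Type} [Fintype κ] [DecidableEq κ] (M : QMap γ κ),
      hadamard κ * (hadamard κ * M) = M := by
    intro κ γ _ _ M
    rw [← Matrix.mul_assoc, hadamard_mul_self, Matrix.one_mul]
  simp only [Matrix.mul_assoc, cancel]
  rw [← Matrix.mul_assoc A, h, ← Matrix.mul_assoc (pauliX v), ← hadamard_mul_pauliZ]
  simp only [Matrix.mul_assoc, Matrix.smul_mul, Matrix.mul_smul]

end LatticeSurgery

/-! ### The main theorem -/

open LatticeSurgery
theorem mainTheorem3 :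
    -- the encoder: both representations agree and have the defining properties of the encoder
    (∀ d e s : ℕ, 0 < d → 0 < e →
      IsEncoder (xStab d e s) (zStab d e s) (logicalX d e) (logicalZ d e) (encoder d e s) ∧
      encoder d e s = zEncoder d e s) ∧
    -- Z-split
    (∀ d e₁ e₂ s : ℕ, 0 < d → 0 < e₁ → 0 < e₂ → ∀ j : Fin (d + 1) → ZMod 2,
      EqUpToPauli ((1 / (√2 : ℝ) : ℂ) ^ (zSplitTiles d e₁ s).length)
        (physZSplit d e₁ e₂ s j * encoder d (e₁ + e₂) s)
        (sideBySideEncoder d e₁ e₂ s * zSplit)) ∧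
    -- X-merge
    (∀ d₁ d₂ e s : ℕ, 0 < d₁ → 0 < d₂ → 0 < e → ∀ j : Fin (e + 1) → ZMod 2,
      EqUpToPauli ((1 / (√2 : ℝ) : ℂ) ^ ((xMergeTiles d₁ e s).length - 1))
        (physXMerge d₁ d₂ e s j * stackedEncoder d₁ d₂ e s)
        (encoder (d₁ + d₂) e s * xMerge ((xMergeTiles d₁ e s).map j).sum)) ∧
    -- X-split
    (∀ d₁ d₂ e s : ℕ, 0 < d₁ → 0 < d₂ → 0 < e → ∀ j : Fin (e + 1) → ZMod 2,
      EqUpToPauli ((1 / (√2 : ℝ) : ℂ) ^ (xSplitTiles d₁ e s).length)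
        (physXSplit d₁ d₂ e s j * encoder (d₁ + d₂) e s)
        (stackedEncoder d₁ d₂ e s * xSplit)) ∧
    -- Z-merge
    (∀ d e₁ e₂ s : ℕ, 0 < d → 0 < e₁ → 0 < e₂ → ∀ j : Fin (d + 1) → ZMod 2,
      EqUpToPauli ((1 / (√2 : ℝ) : ℂ) ^ ((zMergeTiles d e₁ s).length - 1))
        (physZMerge d e₁ e₂ s j * sideBySideEncoder d e₁ e₂ s)
        (encoder d (e₁ + e₂) s * zMerge ((zMergeTiles d e₁ s).map j).sum)) := by
  refine ⟨fun d e s hd he => ⟨(isCSSCode hd he s).isEncoder, encoder_eq_zEncoder hd he s⟩,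
    fun d e₁ e₂ s hd h₁ h₂ j => ?_, fun d₁ d₂ e s h₁ h₂ he j => ?_,
    fun d₁ d₂ e s h₁ h₂ he j => ?_, fun d e₁ e₂ s hd h₁ h₂ j => ?_⟩
  · obtain ⟨v, hv⟩ := exists_physZSplit_mul_encoder hd h₁ h₂ s j
    exact ⟨0, v, hv⟩
  · obtain ⟨v, hv⟩ := exists_physXMerge_mul_stackedEncoder h₁ h₂ he s j
    exact ⟨0, v, hv⟩
  -- Z-split of the transposed patch; s + 1 accounts for the exchange of the two colours.
  · obtain ⟨v, hv⟩ := exists_physZSplit_mul_encoder he h₁ h₂ (s + 1) j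
    rw [physXSplit_eq_hadamard_conj_transpose,
      encoder_eq_hadamard_conj_transpose (Nat.add_pos_left h₁ d₂) he,
      stackedEncoder_eq_hadamard_conj_transpose h₁ h₂ he, xSplit_eq_hadamard_conj,
      xSplitTiles_eq_zSplitTiles]
    exact eqUpToPauli_hadamard_conj (transpose_mul_eq hv)
  · obtain ⟨v, hv⟩ := exists_physXMerge_mul_stackedEncoder h₁ h₂ hd (s + 1) j
    rw [physZMerge_eq_hadamard_conj_transpose,
      encoder_eq_hadamard_conj_transpose hd (Nat.add_pos_left h₁ e₂),
      sideBySideEncoder_eq_hadamard_conj_transpose hd h₁ h₂, zMerge_eq_hadamard_conj,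
      zMergeTiles_eq_xMergeTiles]
    exact eqUpToPauli_hadamard_conj (transpose_mul_eq hv)
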